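/- Let $p>1$, $\nu>0$, $c\in\mathbb R$, $A=\sqrt{1+1/\nu}$, and assume the anti-resonance condition $A/c=2\pi n$ for some integer $n\ge 1$. Write $\mu=A/c$, $\Lambda(x)=\max(1-|x|,0)$, and let $$K_{A,c}(x)=(A^2-1)\Lambda(x)+G(x),\qquad G(x)=\begin{cases}\dfrac{\sin\mu\,\cos(\mu x)-\sin(\mu x)\,\mathrm{sgn}(x)}{\mu}, & |x|<1,\\[2mm] \dfrac{\sin(\mu x)(\cos\mu-1)}{\mu}\,\mathrm{sgn}(x), & |x|\ge 1.\end{cases}$$ For a positive function $\Phi:\mathbb R\to(0,\infty)$ with $\Phi$ and $Z=\Phi^p$ integrable, consider the convolution equation $$A^2c^2\,Z^{1/p}(x)=(K_{A,c}*Z)(x)\quad(x\in\mathbb R)\tag{1}$$ and the Fourier-side traveling-wave equation $$\widehat{\Phi}(\xi)=\frac{1-4\pi^2c^2\nu\xi^2}{1+\nu-4\pi^2c^2\nu\xi^2}\,\frac{\sin^2(\pi\xi)}{c^2\pi^2\xi^2}\,\widehat{\Phi^p}(\xi)\tag{2}$$ for all real $\xi$ at which the denominators do not vanish, where $\hat f(\xi)=\int_{\mathbb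 R} f(x)e^{-2\pi i x\xi}\,dx$. (a) If $A\ge\sqrt2$, there is a bell-shaped $\Phi$, i.e. a positive, even, $C^\infty$ function that is strictly decreasing on $(0,\infty)$, such that $\Phi$ and $\Phi^p$ are integrable, $Z=\Phi^p$ solves (1), $\Phi$ solves (2), and $\Phi$ decays doubly exponentially: there are $C,a>0$ with $\Phi(x)\le C\exp(-a\,p^{|x|})$ for all $x\in\mathbb R$. (b) Let $A_0=\sqrt{1-\inf_{z>0}\frac{\sin z}{z}}$. Then $1.10328\le A_0<1.10329$, and if $A_0\le A<\sqrt2$, there is a positive (not necessarily bell-shaped) function $\Phi$ such that $\Phi$ and $\Phi^p$ are integrable, $Z=\Phi^p$ solves (1), and $\Phi$ solves (2). -/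

import Mathlib

open MeasureTheory Set
open scoped ContDiff FourierTransform

noncomputable section

namespace MiM

/-- The tent function `Λ(x) = (1 - |x|)₊`. -/
def tent (x : ℝ) : ℝ := max (1 - |x|) 0

/-- The oscillatory part `G` of the kernel, with frequency `μ`. -/
def oscKernel (μ x : ℝ) : ℝ :=
  if |x| < 1 then
    (Real.sin μ * Real.cos (μ * x) - Real.sin (μ * x) * SignType.sign x) / μ
  else
    Real.sin (μ * x) * (Real.cos μ - 1) / μ * SignType.sign x

/-- The kernel `K_{A,c} = (A² - 1) Λ + G` with `μ = A / c`. -/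
def kernel (A c x : ℝ) : ℝ := (A ^ 2 - 1) * tent x + oscKernel (A / c) x

/-- The convolution equation `A² c² Z^{1/p} = K_{A,c} * Z`, pointwise on the line, for an
integrable `Z` (so that the convolution with the bounded kernel is a convergent integral). -/
structure SolvesConvolutionEq (p A c : ℝ) (Z : ℝ → ℝ) : Prop where
  integrable : Integrable Z
  eq : ∀ x, A ^ 2 * c ^ 2 * Z x ^ (1 / p) =
    convolution (kernel A c) Z (ContinuousLinearMap.mul ℝ ℝ) volume x

/-- The travelling-wave equation on the Fourier side,
`Φ̂(ξ) = (1 - 4π²c²νξ²) / (1 + ν - 4π²c²νξ²) · sin²(πξ) / (c²π²ξ²) · (Φᵖ)^(ξ)`,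
for `Φ` and `Φᵖ` integrable, at every frequency at which the denominators do not vanish
(the finitely many others are covered by continuity of both transforms).
The Fourier transform is `f̂(ξ) = ∫ f(x) exp(-2πixξ) dx`. -/
structure SolvesFourierEq (p ν c : ℝ) (Φ : ℝ → ℝ) : Prop where
  integrable : Integrable Φ
  integrable_pow : Integrable (fun x => Φ x ^ p)
  eq : ∀ ξ : ℝ, ξ ≠ 0 → 1 + ν - 4 * Real.pi ^ 2 * c ^ 2 * ν * ξ ^ 2 ≠ 0 →
    𝓕 (fun x : ℝ => (Φ x : ℂ)) ξ =
      (((1 - 4 * Real.pi ^ 2 * c ^ 2 * ν * ξ ^ 2) /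
          (1 + ν - 4 * Real.pi ^ 2 * c ^ 2 * ν * ξ ^ 2) *
          (Real.sin (Real.pi * ξ) ^ 2 / (c ^ 2 * Real.pi ^ 2 * ξ ^ 2)) : ℝ) : ℂ) *
        𝓕 (fun x : ℝ => ((Φ x ^ p : ℝ) : ℂ)) ξ

/-- A bell-shaped profile: positive, even, smooth, decreasing on `(0, ∞)`. -/
structure BellShaped (Φ : ℝ → ℝ) : Prop where
  pos : ∀ x, 0 < Φ x
  even : Function.Even Φ
  smooth : ContDiff ℝ ∞ Φ
  decreasing : StrictAntiOn Φ (Ioi 0)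

/-- Doubly exponential decay with base `p`: `Φ(x) ≤ C exp(-a p^{|x|})`. -/
def DoublyExponentialDecay (p : ℝ) (Φ : ℝ → ℝ) : Prop :=
  ∃ C > 0, ∃ a > 0, ∀ x, |Φ x| ≤ C * Real.exp (-(a * p ^ |x|))

/-- The threshold `A₀ = √(1 + a₀)`, where `-a₀ = inf_{z > 0} sin z / z`. -/
def thresholdA : ℝ := √(1 - sInf ((fun z : ℝ => Real.sin z / z) '' Ioi 0))

end MiM

end

/-!
In the anti-resonant case `sin μ = 0`, `cos μ = 1`, the oscillatory part of the kernel vanishes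
outside `[-1, 1]`, and the kernel becomes a function of `y = (1 - |x|)₊`, namely
`K = (A² - 1) y + sin (μ y) / μ` (`kernel_eq_resonantKernel`). It is nonnegative when `A` is at
least the threshold, and strictly decreasing in `|x|` when `A ≥ √2`. What remains is to solve
`κ Φ = K * Φ ^ p` for a nonnegative, even, Lipschitz kernel of compact support, with `p > 1`.

Solutions come from a variational principle on finite lattices. On a cycle of mesh `1 / n` and
length `2 n`, maximise the quadratic form of `K` under a bound on `∑ z ^ (1 + 1/p)`, where
`z = Φ ^ p`. Maximisers exist by compactness, and comparison of a maximiser `z` with `(K * z) ^ p`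
yields the equation, even when `z` is confined to a closed convex cone stable under this map
(`exists_maximiser`). For a decreasing kernel the symmetric decreasing functions on the cycle are
such a cone (`bellCone.convolution_mem`), and this is where the bell shape comes from. The cycle is
preferred to an interval because its translations move the maximum of the solution to the origin
when no symmetry is available, without bringing a boundary to a finite distance.

The lattice solutions have unit energy, their multipliers and maxima are bounded above and below,
and they are Lipschitz uniformly in the mesh. A subsequence therefore converges to a nonzero
solution on the line of finite energy `∫ Φ ^ (p + 1)` (`exists_solution`). It need not be a
maximiser, so no concentration-compactness argument is required. Finite energy and the Lipschitz
bound force `Φ` to vanish at infinity, and then superlinearity gives exponential decay, hence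
integrability (`exists_pos_solution`).

For a decreasing kernel and profile, `Φ (x + 1) ≤ D Φ (x) ^ p`, which gives double exponential
decay; strict monotonicity is a reflection argument (`strictAntiOn_of_solution`), and smoothness a
bootstrap (`contDiff_of_solution`). The Fourier-side equation is the convolution theorem, together
with the explicit symbol of the kernel (`fourier_resonantKernel`, `symbol_identity`).
-/

/-! ### Constrained maximisers in finite dimension -/

/-- Strict convexity of `t ↦ t ^ q`: the graph lies strictly above its tangents. -/
lemma tangent_lt_rpow {q : ℝ} (hq : 1 < q) {u v : ℝ} (hu : 0 ≤ u) (hv : 0 ≤ v) (h : u ≠ v) :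
    v ^ q + q * v ^ (q - 1) * (u - v) < u ^ q := by
  rcases hv.eq_or_lt with rfl | hv
  · have hu' : 0 < u := lt_of_le_of_ne hu (Ne.symm h)
    rw [Real.zero_rpow (by linarith), Real.zero_rpow (by linarith)]
    simpa using Real.rpow_pos_of_pos hu' q
  · have h1 := one_add_mul_self_lt_rpow_one_add (s := u / v - 1)
      (by have := div_nonneg hu hv.le; linarith)
      (by intro h0; apply h; field_simp at h0; linarith) hq
    have hvq : 0 < v ^ q := Real.rpow_pos_of_pos hv q
    rw [show 1 + (u / v - 1) = u / v by ring, Real.div_rpow hu hv.le, lt_div_iff₀ hvq] at h1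
    rw [Real.rpow_sub_one hv.ne']
    calc _ = (1 + q * (u / v - 1)) * v ^ q := by field_simp
      _ < _ := h1

/-- A maximiser of the quadratic form of a symmetric nonnegative matrix `a` under the constraint
`∑ zᵢ ^ (1 + 1/p) ≤ S`, within a closed convex cone that is stable under `z ↦ (a z) ^ p`, solves
the Euler--Lagrange equation `a z = M z ^ (1/p)`. No multiplier for the cone appears, because the
maximiser is compared with the point `(a z) ^ p` of the cone, where Young's inequality is sharp. -/
theorem exists_maximiser {ι : Type*} [Fintype ι] {a : ι → ι → ℝ}
    (hsymm : ∀ i j, a i j = a j i) (ha : ∀ i j, 0 ≤ a i j) {p : ℝ} (hp : 1 < p) {S : ℝ}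
    (hS : 0 < S) {C : Set (ι → ℝ)} (hC : IsClosed C) (hconv : Convex ℝ C)
    (hsmul : ∀ z ∈ C, ∀ t : ℝ, 0 ≤ t → t • z ∈ C)
    (hmap : ∀ z ∈ C, (∀ i, 0 ≤ z i) → (fun i => (∑ j, a i j * z j) ^ p) ∈ C)
    {b : ι → ℝ} (hbC : b ∈ C) (hb : ∀ i, 0 ≤ b i) (hbS : ∑ i, b i ^ (1 + 1 / p) ≤ S)
    (hbpos : 0 < ∑ i, b i * ∑ j, a i j * b j) :
    ∃ z ∈ C, (∀ i, 0 ≤ z i) ∧ ∃ M : ℝ, 0 < M ∧ (∀ i, ∑ j, a i j * z j = M * z i ^ (1 / p)) ∧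
      ∑ i, z i ^ (1 + 1 / p) = S ∧ ∑ i, b i * ∑ j, a i j * b j ≤ M * S := by
  have hp0 : 0 < p := by linarith
  set q := 1 + 1 / p with hq
  have hq1 : 1 < q := by have := one_div_pos.2 hp0; linarith
  let D : Set (ι → ℝ) := {z | z ∈ C ∧ (∀ i, 0 ≤ z i) ∧ ∑ i, z i ^ q ≤ S}
  let B : (ι → ℝ) → (ι → ℝ) → ℝ := fun z w => ∑ i, z i * ∑ j, a i j * w j
  have hBsymm : ∀ z w, B z w = B w z := by
    intro z w
    simp only [B, Finset.mul_sum]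
    rw [Finset.sum_comm]
    refine Finset.sum_congr rfl fun i _ => Finset.sum_congr rfl fun j _ => ?_
    rw [hsymm j i]; ring
  have hDcomp : IsCompact D := by
    refine (isCompact_Icc (a := (0 : ι → ℝ)) (b := fun _ => 1 + S)).of_isClosed_subset ?_ ?_
    · have h1 : IsClosed {z : ι → ℝ | ∀ i, 0 ≤ z i} := by
        simp only [Set.ofPred_forall]
        exact isClosed_iInter fun i => isClosed_le continuous_const (continuous_apply i)
      have h2 : IsClosed {z : ι → ℝ | ∑ i, z i ^ q ≤ S} := by
        refine isClosed_le (continuous_finsetSum _ fun i _ => ?_) continuous_const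
        exact (Real.continuous_rpow_const (by linarith)).comp (continuous_apply i)
      exact hC.inter (h1.inter h2)
    · rintro z ⟨-, hz, hzS⟩
      refine ⟨hz, fun i => ?_⟩
      have h1 : z i ^ q ≤ S :=
        (Finset.single_le_sum (f := fun i => z i ^ q)
          (fun j _ => Real.rpow_nonneg (hz j) q) (Finset.mem_univ i)).trans hzS
      show z i ≤ 1 + S
      rcases le_total (z i) 1 with h | h
      · linarith
      · have := Real.rpow_le_rpow_of_exponent_le h hq1.le
        rw [Real.rpow_one] at this
        linarith
  have hBcont : Continuous fun z : ι → ℝ => B z z := by fun_prop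
  obtain ⟨z, ⟨hzC, hz, hzS⟩, hmax⟩ := hDcomp.exists_isMaxOn ⟨b, hbC, hb, hbS⟩ hBcont.continuousOn
  have hzb : B b b ≤ B z z := hmax (a := b) ⟨hbC, hb, hbS⟩
  set w : ι → ℝ := fun i => ∑ j, a i j * z j with hw
  have hw0 : ∀ i, 0 ≤ w i := fun i => Finset.sum_nonneg fun j _ => mul_nonneg (ha i j) (hz j)
  -- first-order condition along segments
  have hfirst : ∀ y ∈ D, ∑ i, y i * w i ≤ ∑ i, z i * w i := by
    intro y hy
    by_contra! hlt
    have hBe : ∀ t : ℝ, B (z + t • (y - z)) (z + t • (y - z)) =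
        B z z + 2 * t * (∑ i, y i * w i - ∑ i, z i * w i) + t ^ 2 * B (y - z) (y - z) := by
      intro t
      have e1 : ∑ i, y i * w i - ∑ i, z i * w i = B (y - z) z := by
        simp only [B, hw, Pi.sub_apply, sub_mul, Finset.sum_sub_distrib]
      have e2 : B (z + t • (y - z)) (z + t • (y - z)) =
          B z z + t * B (y - z) z + t * B z (y - z) + t ^ 2 * B (y - z) (y - z) := by
        simp only [B, Finset.mul_sum, ← Finset.sum_add_distrib]
        refine Finset.sum_congr rfl fun i _ => Finset.sum_congr rfl fun j _ => ?_
        simp only [Pi.add_apply, Pi.smul_apply, smul_eq_mul]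
        ring
      rw [e2, hBsymm z (y - z), e1]; ring
    set d := ∑ i, y i * w i - ∑ i, z i * w i with hd
    have hd0 : 0 < d := by rw [hd]; linarith
    set e := |B (y - z) (y - z)| with he
    have he0 : 0 ≤ e := abs_nonneg _
    set t := min 1 (d / (e + 1)) with ht
    have ht0 : 0 < t := lt_min one_pos (by positivity)
    have ht1 : t ≤ 1 := min_le_left _ _
    have htd : t * (e + 1) ≤ d := by
      rw [← le_div_iff₀ (by positivity)]; exact min_le_right _ _
    have hmem : z + t • (y - z) ∈ D := by
      have hform : z + t • (y - z) = (1 - t) • z + t • y := by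
        ext i; simp only [Pi.add_apply, Pi.smul_apply, Pi.sub_apply, smul_eq_mul]; ring
      refine ⟨?_, fun i => ?_, ?_⟩
      · rw [hform]; exact hconv hzC hy.1 (by linarith) ht0.le (by ring)
      · rw [hform]
        exact add_nonneg (mul_nonneg (by linarith) (hz i)) (mul_nonneg ht0.le (hy.2.1 i))
      · calc ∑ i, (z + t • (y - z)) i ^ q ≤ ∑ i, ((1 - t) * z i ^ q + t * y i ^ q) := by
              refine Finset.sum_le_sum fun i _ => ?_
              rw [hform]
              exact (convexOn_rpow hq1.le).2 (hz i) (hy.2.1 i) (by linarith) ht0.le (by ring)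
          _ = (1 - t) * ∑ i, z i ^ q + t * ∑ i, y i ^ q := by
              rw [Finset.sum_add_distrib, Finset.mul_sum, Finset.mul_sum]
          _ ≤ (1 - t) * S + t * S := by
              gcongr
              exact hy.2.2
          _ = S := by ring
    have hle : B (z + t • (y - z)) (z + t • (y - z)) ≤ B z z := hmax hmem
    rw [hBe] at hle
    have h3 : -e ≤ B (y - z) (y - z) := neg_abs_le _
    have h4 : 2 * d ≤ t * e := by
      have : t * (2 * d) ≤ t * (t * e) := by nlinarith [sq_nonneg t]
      exact le_of_mul_le_mul_left this ht0
    nlinarith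
  have hBz : B z z = ∑ i, z i * w i := rfl
  -- the competitor `l • w ^ p` saturates the constraint
  have hWpos : 0 < ∑ i, w i ^ (p + 1) := by
    have hne : ∃ i, w i ≠ 0 := by
      by_contra! h
      have : B z z = 0 := by rw [hBz]; simp [h]
      have : 0 < B z z := lt_of_lt_of_le hbpos hzb
      linarith
    obtain ⟨i, hi⟩ := hne
    exact Finset.sum_pos' (fun j _ => Real.rpow_nonneg (hw0 j) _)
      ⟨i, Finset.mem_univ i, Real.rpow_pos_of_pos (lt_of_le_of_ne (hw0 i) (Ne.symm hi)) _⟩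
  set W := ∑ i, w i ^ (p + 1) with hW
  set l := (S / W) ^ (1 / q) with hl
  have hl0 : 0 < l := Real.rpow_pos_of_pos (by positivity) _
  have hlq : l ^ q = S / W := by
    rw [hl, ← Real.rpow_mul (by positivity), one_div_mul_cancel (by linarith), Real.rpow_one]
  set v : ι → ℝ := fun i => l * w i ^ p with hv
  have hv0 : ∀ i, 0 ≤ v i := fun i => mul_nonneg hl0.le (Real.rpow_nonneg (hw0 i) _)
  have hvq : ∑ i, v i ^ q = S := by
    have : ∀ i, v i ^ q = S / W * w i ^ (p + 1) := by
      intro i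
      rw [hv]
      simp only
      rw [Real.mul_rpow hl0.le (Real.rpow_nonneg (hw0 i) _), hlq, ← Real.rpow_mul (hw0 i)]
      congr 2
      rw [hq]; field_simp
    simp_rw [this]
    rw [← Finset.mul_sum, ← hW]; field_simp
  have hvD : v ∈ D := ⟨hsmul _ (hmap z hzC hz) l hl0.le, hv0, hvq.le⟩
  have hvz := hfirst v hvD
  have hvpow : ∀ i, v i ^ (q - 1) = l ^ (1 / p) * w i := by
    intro i
    rw [hv]
    simp only
    rw [Real.mul_rpow hl0.le (Real.rpow_nonneg (hw0 i) _), ← Real.rpow_mul (hw0 i), hq,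
      add_sub_cancel_left, mul_one_div_cancel hp0.ne', Real.rpow_one]
  have hzv : z = v := by
    by_contra hne
    obtain ⟨i, hi⟩ := Function.ne_iff.1 hne
    have hlt : ∑ i, (v i ^ q + q * v i ^ (q - 1) * (z i - v i)) < ∑ i, z i ^ q := by
      refine Finset.sum_lt_sum (fun j _ => ?_) ⟨i, Finset.mem_univ i, tangent_lt_rpow hq1 (hz i) (hv0 i) hi⟩
      by_cases hj : z j = v j
      · rw [hj]; simp
      · exact (tangent_lt_rpow hq1 (hz j) (hv0 j) hj).le
    have : ∑ i, (v i ^ q + q * v i ^ (q - 1) * (z i - v i)) =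
        S + q * l ^ (1 / p) * (∑ i, z i * w i - ∑ i, v i * w i) := by
      rw [Finset.sum_add_distrib, hvq, ← Finset.sum_sub_distrib, Finset.mul_sum]
      congr 1
      refine Finset.sum_congr rfl fun j _ => ?_
      rw [hvpow]; ring
    rw [this] at hlt
    have : 0 ≤ q * l ^ (1 / p) * (∑ i, z i * w i - ∑ i, v i * w i) :=
      mul_nonneg (by positivity) (by linarith)
    linarith
  have hlp : 0 < l ^ (1 / p) := Real.rpow_pos_of_pos hl0 _
  have hwz : ∀ i, w i = (l ^ (1 / p))⁻¹ * z i ^ (1 / p) := by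
    intro i
    have h1 := hvpow i
    rw [← hzv, hq, add_sub_cancel_left] at h1
    rw [h1]; field_simp
  have hzS' : ∑ i, z i ^ q = S := by rw [hzv]; exact hvq
  refine ⟨z, hzC, hz, (l ^ (1 / p))⁻¹, inv_pos.2 hlp, hwz, hzS', ?_⟩
  calc B b b ≤ B z z := hzb
    _ = (l ^ (1 / p))⁻¹ * ∑ i, z i ^ q := by
        rw [hBz, Finset.mul_sum]
        refine Finset.sum_congr rfl fun i _ => ?_
        rw [hwz, hq, add_comm 1 (1 / p), Real.rpow_add_one' (hz i) (by positivity)]; ring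
    _ = (l ^ (1 / p))⁻¹ * S := by rw [hzS']

/-! ### Periodic lattice solutions -/

/-- The kernels for which solutions are constructed: nonnegative, even, Lipschitz, supported in
`[-1, 1]` and positive at the origin. -/
structure BumpKernel (K : ℝ → ℝ) (L : ℝ) : Prop where
  nonneg : ∀ x, 0 ≤ K x
  even : ∀ x, K (-x) = K x
  vanish : ∀ x, 1 ≤ |x| → K x = 0
  lip : ∀ x y, |K x - K y| ≤ L * |x - y|
  pos : 0 < K 0

namespace BumpKernel

variable {K : ℝ → ℝ} {L : ℝ}

lemma abs_eq (hK : BumpKernel K L) (x : ℝ) : K |x| = K x := by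
  rcases abs_choice x with h | h <;> rw [h]
  exact hK.even x

lemma lip_pos (hK : BumpKernel K L) : 0 < L := by
  have h := hK.lip 0 1
  rw [hK.vanish 1 (by simp)] at h
  have h0 := hK.pos
  rw [sub_zero, abs_of_pos h0] at h
  norm_num at h
  linarith

lemma le_lip (hK : BumpKernel K L) (x : ℝ) : K x ≤ L := by
  have hL := hK.lip_pos
  by_cases hx : 1 ≤ |x|
  · rw [hK.vanish x hx]; exact hL.le
  · push Not at hx
    have h := hK.lip |x| 1
    rw [hK.vanish 1 (by simp), hK.abs_eq, sub_zero, abs_of_nonneg (hK.nonneg x)] at h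
    have h1 : |(|x| - 1)| ≤ 1 := by
      rw [abs_le]; constructor <;> linarith [abs_nonneg x]
    calc K x ≤ L * |(|x| - 1)| := h
      _ ≤ L * 1 := by gcongr
      _ = L := mul_one L

lemma continuous (hK : BumpKernel K L) : Continuous K :=
  (LipschitzWith.of_dist_le_mul (K := L.toNNReal) fun x y => by
    rw [Real.dist_eq, Real.dist_eq, Real.coe_toNNReal _ hK.lip_pos.le]; exact hK.lip x y).continuous

end BumpKernel

/-- Solutions `φ` on the lattice of mesh `1 / n`, of period `2 n`, of the discretised equation
`M φ = K * φ ^ p`, with their maximum at the origin and unit energy `∑ φ ^ (p + 1) / n` per period.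
The sum may be taken over any finite set of sites that contains the support of the kernel. -/
structure LatticeSolution (K : ℝ → ℝ) (p : ℝ) (n : ℕ) (M : ℝ) (φ : ℤ → ℝ) : Prop where
  nonneg : ∀ i, 0 ≤ φ i
  le_zero : ∀ i, φ i ≤ φ 0
  eq : ∀ (i : ℤ) (T : Finset ℤ), Finset.Ioo (i - n) (i + n) ⊆ T →
    M * φ i = 1 / n * ∑ j ∈ T, K ((i - j) / n) * φ j ^ p
  energy : ∀ a : ℤ, ∑ j ∈ Finset.Ico a (a + 2 * n ^ 2), φ j ^ (p + 1) = n

lemma ZMod.sum_eq_sum_Ico (N : ℕ) [NeZero N] (f : ZMod N → ℝ) (a : ℤ) :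
    ∑ r, f r = ∑ j ∈ Finset.Ico a (a + N), f (j : ZMod N) := by
  have hinj : Set.InjOn (fun j : ℤ => (j : ZMod N)) (Finset.Ico a (a + N)) := by
    intro x hx y hy hxy
    simp only [Finset.coe_Ico, Set.mem_Ico] at hx hy
    have h1 := (ZMod.intCast_eq_intCast_iff_dvd_sub x y N).1 hxy
    obtain ⟨k, hk⟩ := h1
    have hN : (0 : ℤ) < N := by exact_mod_cast Nat.pos_of_ne_zero (NeZero.ne N)
    have hk0 : k = 0 := by
      have h2 : (N : ℤ) * k < N * 1 := by linarith
      have h3 : (N : ℤ) * (-1) < N * k := by linarith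
      have := lt_of_mul_lt_mul_left h2 hN.le
      have := lt_of_mul_lt_mul_left h3 hN.le
      omega
    rw [hk0, mul_zero] at hk
    linarith
  have himg : (Finset.Ico a (a + N)).image (fun j : ℤ => (j : ZMod N)) = Finset.univ := by
    rw [← Finset.card_eq_iff_eq_univ, Finset.card_image_of_injOn hinj, Int.card_Ico, ZMod.card]
    simp
  rw [← himg, Finset.sum_image hinj]

/-- The reflection in the point `i + 1/2` pairs the sites of the cycle. -/
lemma ZMod.sum_eq_sum_pairs (m : ℕ) [NeZero (2 * m)] (f : ZMod (2 * m) → ℝ) (i : ℤ) :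
    ∑ r, f r = ∑ s ∈ Finset.range m,
      (f ((i - s : ℤ) : ZMod (2 * m)) + f ((i + 1 + s : ℤ) : ZMod (2 * m))) := by
  rw [ZMod.sum_eq_sum_Ico (2 * m) f (i + 1 - m)]
  have h1 : ∑ j ∈ Finset.Ico (i + 1 - m) (i + 1 - m + (2 * m : ℕ)), f (j : ZMod (2 * m)) =
      ∑ s ∈ Finset.range (m + m), f ((i + 1 - m + s : ℤ) : ZMod (2 * m)) := by
    refine Finset.sum_nbij' (fun j => (j - (i + 1 - m)).toNat) (fun s => i + 1 - m + s) ?_ ?_ ?_ ?_ ?_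
    · intro j hj; simp only [Finset.mem_Ico, Finset.mem_range] at hj ⊢; push_cast at hj; omega
    · intro j hj; simp only [Finset.mem_Ico, Finset.mem_range] at hj ⊢; push_cast; omega
    · intro j hj; simp only [Finset.mem_Ico] at hj; omega
    · intro j hj; simp
    · intro j hj
      simp only [Finset.mem_Ico] at hj
      congr 2; omega
  rw [h1, Finset.sum_range_add, Finset.sum_add_distrib, ← Finset.sum_range_reflect]
  refine congr_arg₂ _ (Finset.sum_congr rfl fun s hs => ?_) (Finset.sum_congr rfl fun s hs => ?_)
  · have := Finset.mem_range.1 hs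
    congr 2; omega
  · congr 2; push_cast; ring

lemma ZMod.natAbs_valMinAbs_intCast {m : ℕ} [NeZero (2 * m)] {x : ℤ} (hx : x.natAbs ≤ m) :
    (x : ZMod (2 * m)).valMinAbs.natAbs = x.natAbs := by
  by_cases h : x = -m
  · rw [h, Int.cast_neg, ZMod.natAbs_valMinAbs_neg, Int.cast_natCast,
      ZMod.valMinAbs_natCast_of_le_half (by omega)]
    simp
  · rw [(ZMod.valMinAbs_spec _ x).2]
    refine ⟨rfl, ?_⟩
    simp only [Set.mem_Ioc]
    push_cast
    omega

/-- Symmetric decreasing functions on the cycle of even length. -/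
def bellCone (m : ℕ) : Set (ZMod (2 * m) → ℝ) :=
  {z | (∀ r, z (-r) = z r) ∧ ∀ t : ℕ, t < m → z (t + 1 : ℕ) ≤ z t}

lemma bellCone.le {m : ℕ} {z : ZMod (2 * m) → ℝ} (hz : z ∈ bellCone m) {x y : ℤ}
    (hxy : x.natAbs ≤ y.natAbs) (hy : y.natAbs ≤ m) : z (y : ZMod (2 * m)) ≤ z (x : ZMod (2 * m)) := by
  have habs : ∀ x : ℤ, z (x : ZMod (2 * m)) = z (x.natAbs : ZMod (2 * m)) := by
    intro x
    rcases Int.natAbs_eq x with h | h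
    · conv_lhs => rw [h]
      rw [Int.cast_natCast]
    · conv_lhs => rw [h]
      rw [Int.cast_neg, hz.1, Int.cast_natCast]
  rw [habs x, habs y]
  obtain ⟨k, hk⟩ := Nat.exists_eq_add_of_le hxy
  have : ∀ k a : ℕ, a + k ≤ m → z ((a + k : ℕ) : ZMod (2 * m)) ≤ z (a : ZMod (2 * m)) := by
    intro k a
    induction k with
    | zero => intro _; simp
    | succ k ih => intro h; exact (hz.2 (a + k) (by omega)).trans (ih (by omega))
  rw [hk]
  exact this k _ (by omega)

lemma bellCone.isClosed (m : ℕ) : IsClosed (bellCone m) := by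
  have h1 : IsClosed {z : ZMod (2 * m) → ℝ | ∀ r, z (-r) = z r} := by
    simp only [Set.ofPred_forall]
    exact isClosed_iInter fun r => isClosed_eq (continuous_apply _) (continuous_apply _)
  have h2 : IsClosed {z : ZMod (2 * m) → ℝ | ∀ t : ℕ, t < m → z (t + 1 : ℕ) ≤ z t} := by
    simp only [Set.ofPred_forall]
    exact isClosed_iInter fun t => isClosed_iInter fun _ =>
      isClosed_le (continuous_apply _) (continuous_apply _)
  exact h1.inter h2

lemma bellCone.convex (m : ℕ) : Convex ℝ (bellCone m) := by
  intro z hz w hw a b ha hb _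
  refine ⟨fun r => ?_, fun t ht => ?_⟩
  · simp only [Pi.add_apply, Pi.smul_apply, hz.1, hw.1]
  · simp only [Pi.add_apply, Pi.smul_apply, smul_eq_mul]
    have := hz.2 t ht
    have := hw.2 t ht
    gcongr

lemma bellCone.smul_mem {m : ℕ} {z : ZMod (2 * m) → ℝ} (hz : z ∈ bellCone m) {t : ℝ} (ht : 0 ≤ t) :
    t • z ∈ bellCone m := by
  refine ⟨fun r => ?_, fun s hs => ?_⟩
  · simp only [Pi.smul_apply, hz.1]
  · simp only [Pi.smul_apply, smul_eq_mul]
    have := hz.2 s hs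
    gcongr

/-- The Riesz-type rearrangement property of the cycle: convolution preserves the symmetric
decreasing functions. -/
lemma bellCone.convolution_mem {m : ℕ} [NeZero (2 * m)] {k z : ZMod (2 * m) → ℝ}
    (hk : k ∈ bellCone m) (hz : z ∈ bellCone m) : (fun i => ∑ j, k (i - j) * z j) ∈ bellCone m := by
  refine ⟨fun r => ?_, fun t ht => ?_⟩
  · show ∑ j, k (-r - j) * z j = ∑ j, k (r - j) * z j
    rw [← Equiv.sum_comp (Equiv.neg _)]
    refine Finset.sum_congr rfl fun j _ => ?_
    rw [Equiv.neg_apply, hz.1, ← hk.1]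
    congr 2; ring
  · rw [← sub_nonneg, ← Finset.sum_sub_distrib, ZMod.sum_eq_sum_pairs m _ t]
    refine Finset.sum_nonneg fun s hs => ?_
    rw [Finset.mem_range] at hs
    have e1 : k ((t : ℕ) - ((t - s : ℤ) : ZMod (2 * m))) = k ((s : ℤ) : ZMod (2 * m)) := by
      congr 1; push_cast; ring
    have e2 : k ((t + 1 : ℕ) - ((t - s : ℤ) : ZMod (2 * m))) = k ((s + 1 : ℤ) : ZMod (2 * m)) := by
      congr 1; push_cast; ring
    have e3 : k ((t : ℕ) - ((t + 1 + s : ℤ) : ZMod (2 * m))) = k ((s + 1 : ℤ) : ZMod (2 * m)) := by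
      rw [← hk.1]; congr 1; push_cast; ring
    have e4 : k ((t + 1 : ℕ) - ((t + 1 + s : ℤ) : ZMod (2 * m))) = k ((s : ℤ) : ZMod (2 * m)) := by
      rw [← hk.1]; congr 1; push_cast; ring
    rw [e1, e2, e3, e4]
    have h1 : k ((s + 1 : ℤ) : ZMod (2 * m)) ≤ k ((s : ℤ) : ZMod (2 * m)) :=
      bellCone.le hk (by omega) (by omega)
    have h2 : z ((t + 1 + s : ℤ) : ZMod (2 * m)) ≤ z ((t - s : ℤ) : ZMod (2 * m)) := by
      by_cases h : t + 1 + s ≤ m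
      · exact bellCone.le hz (by omega) (by omega)
      · have e : ((t + 1 + s : ℤ) : ZMod (2 * m)) = ((t + 1 + s - (2 * m : ℕ) : ℤ) : ZMod (2 * m)) := by
          rw [Int.cast_sub, Int.cast_natCast (2 * m), ZMod.natCast_self, sub_zero]
        rw [e]
        exact bellCone.le hz (by omega) (by omega)
    nlinarith [mul_nonneg (sub_nonneg.2 h1) (sub_nonneg.2 h2)]

lemma bellCone.rpow_mem {m : ℕ} {z : ZMod (2 * m) → ℝ} (hz : z ∈ bellCone m)
    (hz0 : ∀ r, 0 ≤ z r) {p : ℝ} (hp : 0 ≤ p) : (fun r => z r ^ p) ∈ bellCone m :=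
  ⟨fun r => by simp only [hz.1], fun t ht => Real.rpow_le_rpow (hz0 _) (hz.2 t ht) hp⟩

lemma bellCone.of_antitone {m : ℕ} [NeZero (2 * m)] {g : ℕ → ℝ} (hg : Antitone g) :
    (fun r : ZMod (2 * m) => g r.valMinAbs.natAbs) ∈ bellCone m := by
  refine ⟨fun r => by simp only [ZMod.natAbs_valMinAbs_neg], fun t ht => hg ?_⟩
  have h1 := ZMod.natAbs_valMinAbs_intCast (m := m) (x := t) (by omega)
  have h2 := ZMod.natAbs_valMinAbs_intCast (m := m) (x := (t + 1 : ℕ)) (by omega)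
  rw [Int.cast_natCast] at h1 h2
  rw [h1, h2]
  omega

/-- Number of sites within distance `s` of the origin. -/
lemma ZMod.card_ball {m : ℕ} [NeZero (2 * m)] {s : ℕ} (hs : s ≤ m) :
    s + 1 ≤ (Finset.univ.filter fun r : ZMod (2 * m) => r.valMinAbs.natAbs ≤ s).card ∧
      (Finset.univ.filter fun r : ZMod (2 * m) => r.valMinAbs.natAbs ≤ s).card ≤ 2 * s + 1 := by
  constructor
  · have : (Finset.range (s + 1)).card ≤
        (Finset.univ.filter fun r : ZMod (2 * m) => r.valMinAbs.natAbs ≤ s).card := by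
      refine Finset.card_le_card_of_injOn (fun t : ℕ => ((t : ℤ) : ZMod (2 * m))) ?_ ?_
      · intro t ht
        simp only [Finset.coe_range, Set.mem_Iio] at ht
        have := ZMod.natAbs_valMinAbs_intCast (m := m) (x := t) (by omega)
        simp only [Finset.coe_filter, Finset.mem_univ, true_and, Set.mem_ofPred_eq]
        omega
      · intro t ht u hu htu
        simp only [Finset.coe_range, Set.mem_Iio] at ht hu
        have h1 := ZMod.natAbs_valMinAbs_intCast (m := m) (x := t) (by omega)
        have h2 := ZMod.natAbs_valMinAbs_intCast (m := m) (x := u) (by omega)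
        simp only at htu
        rw [htu] at h1
        omega
    simpa using this
  · have : (Finset.univ.filter fun r : ZMod (2 * m) => r.valMinAbs.natAbs ≤ s).card ≤
        (Finset.Icc (-s : ℤ) s).card := by
      refine Finset.card_le_card_of_injOn (fun r => r.valMinAbs) ?_
        (fun a _ b _ h => ZMod.injective_valMinAbs h)
      intro r hr
      simp only [Finset.coe_filter, Finset.mem_univ, true_and, Set.mem_ofPred_eq] at hr
      simp only [Finset.coe_Icc, Set.mem_Icc]
      omega
    rw [Int.card_Icc] at this
    omega

/-- Lattice solutions exist for every mesh, with a multiplier `M` that stays away from `0` as the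
mesh tends to `0`. If the kernel is decreasing, then so is the solution, up to half the period. -/
theorem exists_latticeSolution {K : ℝ → ℝ} {L : ℝ} (hK : BumpKernel K L) {p : ℝ} (hp : 1 < p) :
    ∃ c > 0, ∀ n : ℕ, 2 ≤ n → ∃ M ≥ c, ∃ φ : ℤ → ℝ, LatticeSolution K p n M φ ∧
      (AntitoneOn K (Ici 0) → (∀ i, φ (-i) = φ i) ∧
        ∀ i j : ℤ, i.natAbs ≤ j.natAbs → j.natAbs ≤ n ^ 2 → φ j ≤ φ i) := by
  have hp0 : 0 < p := by linarith
  have hL := hK.lip_pos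
  have hK0 := hK.pos
  set δ := min (1 / 4) (K 0 / (4 * L)) with hδ
  have hδ0 : 0 < δ := by positivity
  have hδ4 : δ ≤ 1 / 4 := min_le_left _ _
  have hδL : 4 * L * δ ≤ K 0 := by
    have : δ ≤ K 0 / (4 * L) := min_le_right _ _
    rw [le_div_iff₀ (by positivity)] at this
    linarith
  have hKlow : ∀ x, |x| ≤ 2 * δ → K 0 / 2 ≤ K x := by
    intro x hx
    have h1 := hK.lip 0 x
    rw [zero_sub, abs_neg] at h1
    have h2 : L * |x| ≤ L * (2 * δ) := by gcongr
    have := le_abs_self (K 0 - K x)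
    linarith
  refine ⟨K 0 / 2 * δ ^ 2, by positivity, fun n hn => ?_⟩
  have hn0 : (0 : ℝ) < n := by exact_mod_cast (by omega : 0 < n)
  have hnn : n ≤ n ^ 2 := by nlinarith
  have : NeZero (2 * n ^ 2) := ⟨by positivity⟩
  set m := n ^ 2 with hm
  let d : ZMod (2 * m) → ℕ := fun r => r.valMinAbs.natAbs
  let k : ZMod (2 * m) → ℝ := fun r => 1 / n * K (d r / n)
  have hd_neg : ∀ r, d (-r) = d r := fun r => ZMod.natAbs_valMinAbs_neg r
  have hk_neg : ∀ r, k (-r) = k r := fun r => by simp only [k, hd_neg]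
  have hk_nonneg : ∀ r, 0 ≤ k r := fun r => mul_nonneg (by positivity) (hK.nonneg _)
  have hk_int : ∀ x : ℤ, x.natAbs ≤ m → k (x : ZMod (2 * m)) = 1 / n * K (x / n) := by
    intro x hx
    simp only [k, d]
    rw [ZMod.natAbs_valMinAbs_intCast hx, ← hK.abs_eq (x / n), abs_div, Nat.abs_cast,
      Nat.cast_natAbs, Int.cast_abs]
  have hd_sub : ∀ r s, d (r - s) ≤ d r + d s := by
    intro r s
    rw [sub_eq_add_neg, ← hd_neg s]
    exact (ZMod.natAbs_valMinAbs_add_le r (-s)).trans (Int.natAbs_add_le _ _)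
  -- the cone: everything, or the symmetric decreasing functions
  obtain ⟨C, hCcl, hCconv, hCsmul, hCmap, hCanti, hCbell⟩ : ∃ C : Set (ZMod (2 * m) → ℝ),
      IsClosed C ∧ Convex ℝ C ∧ (∀ z ∈ C, ∀ t : ℝ, 0 ≤ t → t • z ∈ C) ∧
      (∀ z ∈ C, (∀ i, 0 ≤ z i) → (fun i => (∑ j, k (i - j) * z j) ^ p) ∈ C) ∧
      (∀ g : ℕ → ℝ, Antitone g → (fun r => g (d r)) ∈ C) ∧
      (AntitoneOn K (Ici 0) → C ⊆ bellCone m) := by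
    by_cases hanti : AntitoneOn K (Ici 0)
    · refine ⟨bellCone m, bellCone.isClosed m, bellCone.convex m,
        fun z hz t ht => bellCone.smul_mem hz ht, fun z hz hz0 => ?_,
        fun g hg => bellCone.of_antitone hg, fun _ => subset_rfl⟩
      refine bellCone.rpow_mem (bellCone.convolution_mem ?_ hz)
        (fun r => Finset.sum_nonneg fun j _ => mul_nonneg (hk_nonneg _) (hz0 j)) hp0.le
      refine bellCone.of_antitone (g := fun t : ℕ => 1 / (n : ℝ) * K (t / n)) fun s t hst => ?_
      have : (s : ℝ) / n ≤ t / n := by gcongr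
      have := hanti (Set.mem_Ici.2 (by positivity)) (Set.mem_Ici.2 (by positivity)) this
      show 1 / (n : ℝ) * K (t / n) ≤ 1 / (n : ℝ) * K (s / n)
      gcongr
    · exact ⟨Set.univ, isClosed_univ, convex_univ, by simp, by simp, by simp,
        fun h => absurd h hanti⟩
  -- the test function: the indicator of the sites within distance `δ`
  set s := ⌊δ * n⌋₊ with hs
  have hs1 : (s : ℝ) ≤ δ * n := Nat.floor_le (by positivity)
  have hs2 : δ * n < s + 1 := Nat.lt_floor_add_one _
  have hs4 : 4 * s ≤ n := by
    have : (4 * s : ℝ) ≤ n := by nlinarith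
    exact_mod_cast this
  have hcard := ZMod.card_ball (m := m) (s := s) (by omega)
  set U := Finset.univ.filter fun r : ZMod (2 * m) => r.valMinAbs.natAbs ≤ s with hU
  let b : ZMod (2 * m) → ℝ := fun r => if d r ≤ s then 1 else 0
  have hbC : b ∈ C := by
    refine hCanti (fun t => if t ≤ s then 1 else 0) fun t u htu => ?_
    show (if u ≤ s then (1 : ℝ) else 0) ≤ if t ≤ s then 1 else 0
    split_ifs <;> first | omega | norm_num
  have hb0 : ∀ i, 0 ≤ b i := fun i => by simp only [b]; split_ifs <;> norm_num
  have hbS : ∑ i, b i ^ (1 + 1 / p) ≤ (n : ℝ) := by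
    have h1 : ∀ i, b i ^ (1 + 1 / p) = if d i ≤ s then 1 else 0 := by
      intro i
      simp only [b]
      split_ifs
      · simp
      · exact Real.zero_rpow (by positivity)
    simp_rw [h1]
    rw [Finset.sum_boole]
    exact_mod_cast hcard.2.trans (by omega)
  have hbW : (U.card : ℝ) ^ 2 * (1 / n * (K 0 / 2)) ≤ ∑ i, b i * ∑ j, k (i - j) * b j := by
    have h1 : ∀ i, (if d i ≤ s then U.card * (1 / n * (K 0 / 2)) else 0) ≤
        b i * ∑ j, k (i - j) * b j := by
      intro i
      by_cases hi : d i ≤ s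
      · simp only [b, hi, if_true, one_mul]
        calc U.card * (1 / n * (K 0 / 2)) = ∑ j, if d j ≤ s then 1 / n * (K 0 / 2) else 0 := by
              rw [← Finset.sum_filter, Finset.sum_const, nsmul_eq_mul]
          _ ≤ _ := by
              refine Finset.sum_le_sum fun j _ => ?_
              by_cases hj : d j ≤ s
              · simp only [hj, if_true, mul_one, k]
                refine mul_le_mul_of_nonneg_left (hKlow _ ?_) (by positivity)
                rw [abs_of_nonneg (by positivity), div_le_iff₀ hn0]
                have : (d (i - j) : ℝ) ≤ s + s := by
                  exact_mod_cast (hd_sub i j).trans (add_le_add hi hj)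
                linarith
              · simp [hj]
      · simp [b, hi]
    calc _ = ∑ i, if d i ≤ s then U.card * (1 / n * (K 0 / 2)) else 0 := by
          rw [← Finset.sum_filter, Finset.sum_const, nsmul_eq_mul]; ring
      _ ≤ _ := Finset.sum_le_sum fun i _ => h1 i
  have hUpos : δ * n ≤ U.card := by
    have : ((s + 1 : ℕ) : ℝ) ≤ U.card := by exact_mod_cast hcard.1
    push_cast at this
    linarith
  have hW0 : 0 < (U.card : ℝ) ^ 2 * (1 / n * (K 0 / 2)) := by
    have : (0 : ℝ) < U.card := lt_of_lt_of_le (by positivity) hUpos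
    positivity
  obtain ⟨z, hzC, hz0, M, hM, hzeq, hzS, hMS⟩ := exists_maximiser (a := fun i j => k (i - j))
    (fun i j => by rw [← hk_neg, neg_sub]) (fun i j => hk_nonneg _) hp hn0 hCcl hCconv hCsmul
    hCmap hbC hb0 hbS (hW0.trans_le hbW)
  have hMc : K 0 / 2 * δ ^ 2 ≤ M := by
    have h1 : (δ * n) ^ 2 * (1 / n * (K 0 / 2)) ≤ M * n := by
      refine le_trans ?_ (hbW.trans hMS)
      gcongr
    have h2 : (δ * n) ^ 2 * (1 / n * (K 0 / 2)) = (K 0 / 2 * δ ^ 2) * n := by field_simp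
    rw [h2] at h1
    exact le_of_mul_le_mul_right h1 hn0
  -- the maximum is moved to the origin
  obtain ⟨r₀, hr₀, hr₀'⟩ : ∃ r₀, (∀ r, z r ≤ z r₀) ∧ (AntitoneOn K (Ici 0) → r₀ = 0) := by
    by_cases hanti : AntitoneOn K (Ici 0)
    · refine ⟨0, fun r => ?_, fun _ => rfl⟩
      have := bellCone.le (hCbell hanti hzC) (x := 0) (y := r.valMinAbs) (by simp)
        ((ZMod.natAbs_valMinAbs_le r).trans (by omega))
      rwa [ZMod.coe_valMinAbs, Int.cast_zero] at this
    · obtain ⟨r, -, hr⟩ := Finset.exists_max_image Finset.univ z Finset.univ_nonempty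
      exact ⟨r, fun r' => hr r' (Finset.mem_univ _), fun h => absurd h hanti⟩
  have hpow : ∀ r, (z r ^ (1 / p)) ^ p = z r := fun r => by
    rw [← Real.rpow_mul (hz0 r), one_div_mul_cancel hp0.ne', Real.rpow_one]
  refine ⟨M, hMc, fun i => z ((i : ZMod (2 * m)) + r₀) ^ (1 / p), ⟨?_, ?_, ?_, ?_⟩, ?_⟩
  · exact fun i => Real.rpow_nonneg (hz0 _) _
  · intro i
    refine Real.rpow_le_rpow (hz0 _) ?_ (by positivity)
    simpa using hr₀ _
  · intro i T hT
    simp only [hpow]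
    have hsupp : ∀ j : ℤ, j ∉ Finset.Ioo (i - n) (i + n) → K ((i - j) / n) = 0 := by
      intro j hj
      refine hK.vanish _ ?_
      rw [abs_div, Nat.abs_cast, le_div_iff₀ hn0, one_mul]
      have h1 : (n : ℤ) ≤ |i - j| := by
        rw [Finset.mem_Ioo, not_and_or] at hj
        rw [le_abs]; omega
      have : ((n : ℤ) : ℝ) ≤ ((|i - j| : ℤ) : ℝ) := by exact_mod_cast h1
      push_cast at this
      exact this
    rw [← Finset.sum_subset hT (fun j _ hj => by rw [hsupp j hj, zero_mul]), ← hzeq,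
      ← Equiv.sum_comp (Equiv.addRight r₀), ZMod.sum_eq_sum_Ico (2 * m) _ (i - m), Finset.mul_sum]
    symm
    have hsub : Finset.Ioo (i - n) (i + n) ⊆ Finset.Ico (i - m) (i - m + (2 * m : ℕ)) := by
      intro j hj
      rw [Finset.mem_Ioo] at hj
      rw [Finset.mem_Ico]
      push_cast
      have : (n : ℤ) ≤ m := by exact_mod_cast hnn
      omega
    have hterm : ∀ j ∈ Finset.Ico (i - m) (i - m + (2 * m : ℕ)),
        k ((i : ZMod (2 * m)) + r₀ - Equiv.addRight r₀ (j : ZMod (2 * m))) =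
          1 / n * K ((i - j) / n) := by
      intro j hj
      rw [Finset.mem_Ico] at hj
      push_cast at hj
      have := hk_int (i - j) (by omega)
      push_cast at this
      rw [← this, Equiv.coe_addRight, add_sub_add_right_eq_sub]
    refine (Finset.sum_subset_zero_on_sdiff hsub (fun j hj => ?_) (fun j hj => ?_))
    · rw [Finset.mem_sdiff] at hj
      rw [hterm j hj.1, hsupp j hj.2, mul_zero, zero_mul]
    · rw [hterm j (hsub hj), Equiv.coe_addRight, mul_assoc]
  · intro a
    rw [← hzS, ← Equiv.sum_comp (Equiv.addRight r₀), ZMod.sum_eq_sum_Ico (2 * m) _ a]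
    refine Finset.sum_congr (by rw [hm]; push_cast; rfl) fun j _ => ?_
    rw [Equiv.coe_addRight, ← Real.rpow_mul (hz0 _)]
    congr 1
    field_simp
  · intro hanti
    have hbell := hCbell hanti hzC
    rw [hr₀' hanti]
    simp only [add_zero]
    refine ⟨fun i => by rw [Int.cast_neg, hbell.1], fun i j hij hj => ?_⟩
    exact Real.rpow_le_rpow (hz0 _) (bellCone.le hbell hij hj) (by positivity)

/-! ### Uniform estimates and step functions -/

namespace LatticeSolution

variable {K : ℝ → ℝ} {L p M : ℝ} {n : ℕ} {φ : ℤ → ℝ}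

lemma zero_pos (h : LatticeSolution K p n M φ) (hp : 1 < p) (hn : 2 ≤ n) : 0 < φ 0 := by
  refine lt_of_le_of_ne (h.nonneg 0) fun h0 => ?_
  have h1 : ∀ i, φ i = 0 := fun i => le_antisymm (h0 ▸ h.le_zero i) (h.nonneg i)
  have h2 := h.energy 0
  simp only [h1, Real.zero_rpow (by linarith : p + 1 ≠ 0), Finset.sum_const_zero] at h2
  have : (0 : ℝ) < n := by exact_mod_cast (by omega : 0 < n)
  linarith

/-- Over a window of bounded length, `φ ^ p ≤ 1 + φ ^ (p + 1)` controls the mass by the energy. -/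
lemma sum_rpow_le (h : LatticeSolution K p n M φ) (hp : 1 < p) (hn : 2 ≤ n) (i : ℤ) :
    1 / n * ∑ j ∈ Finset.Ioo (i - n) (i + 1 + n), φ j ^ p ≤ 3 := by
  have hn0 : (0 : ℝ) < n := by exact_mod_cast (by omega : 0 < n)
  have h1 : ∀ j, φ j ^ p ≤ 1 + φ j ^ (p + 1) := by
    intro j
    have h0 := h.nonneg j
    rcases le_total (φ j) 1 with hj | hj
    · have := Real.rpow_le_one h0 hj (by linarith : 0 ≤ p)
      have := Real.rpow_nonneg h0 (p + 1)
      linarith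
    · have := Real.rpow_le_rpow_of_exponent_le hj (by linarith : p ≤ p + 1)
      linarith
  have h2 : ∑ j ∈ Finset.Ioo (i - n) (i + 1 + n), φ j ^ (p + 1) ≤ n := by
    rw [← h.energy (i - n)]
    refine Finset.sum_le_sum_of_subset_of_nonneg (fun j hj => ?_)
      (fun j _ _ => Real.rpow_nonneg (h.nonneg j) _)
    have : (n : ℤ) * 2 ≤ n ^ 2 := by
      have : (2 : ℤ) ≤ n := by exact_mod_cast hn
      nlinarith
    rw [Finset.mem_Ioo] at hj
    rw [Finset.mem_Ico]
    omega
  have h3 : ∑ j ∈ Finset.Ioo (i - n) (i + 1 + n), φ j ^ p ≤ 2 * n + n := by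
    calc _ ≤ ∑ j ∈ Finset.Ioo (i - n) (i + 1 + n), (1 + φ j ^ (p + 1)) :=
          Finset.sum_le_sum fun j _ => h1 j
      _ = ((Finset.Ioo (i - n) (i + 1 + n)).card : ℝ) +
          ∑ j ∈ Finset.Ioo (i - n) (i + 1 + n), φ j ^ (p + 1) := by
          rw [Finset.sum_add_distrib, Finset.sum_const, nsmul_eq_mul, mul_one]
      _ ≤ _ := by
          have : (Finset.Ioo (i - n) (i + 1 + n)).card = 2 * n := by rw [Int.card_Ioo]; omega
          rw [this]
          push_cast
          linarith
  rw [one_div, inv_mul_le_iff₀ hn0]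
  linarith

lemma le_bound (h : LatticeSolution K p n M φ) (hK : BumpKernel K L) (hp : 1 < p) (hn : 2 ≤ n)
    {c : ℝ} (hc : 0 < c) (hM : c ≤ M) (i : ℤ) : φ i ≤ 3 * L / c := by
  have h1 := h.eq i (Finset.Ioo (i - n) (i + 1 + n)) (Finset.Ioo_subset_Ioo_right (by omega))
  rw [le_div_iff₀ hc]
  calc φ i * c ≤ φ i * M := mul_le_mul_of_nonneg_left hM (h.nonneg i)
    _ = 1 / n * ∑ j ∈ Finset.Ioo (i - n) (i + 1 + n), K ((i - j) / n) * φ j ^ p := by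
        rw [mul_comm, h1]
    _ ≤ 1 / n * ∑ j ∈ Finset.Ioo (i - n) (i + 1 + n), L * φ j ^ p := by
        gcongr with j _
        · exact Real.rpow_nonneg (h.nonneg j) _
        · exact hK.le_lip _
    _ = L * (1 / n * ∑ j ∈ Finset.Ioo (i - n) (i + 1 + n), φ j ^ p) := by
        rw [← Finset.mul_sum]; ring
    _ ≤ L * 3 := mul_le_mul_of_nonneg_left (h.sum_rpow_le hp hn i) hK.lip_pos.le
    _ = 3 * L := mul_comm _ _

lemma abs_sub_succ_le (h : LatticeSolution K p n M φ) (hK : BumpKernel K L) (hp : 1 < p)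
    (hn : 2 ≤ n) {c : ℝ} (hc : 0 < c) (hM : c ≤ M) (i : ℤ) :
    |φ (i + 1) - φ i| ≤ 3 * L / c * (1 / n) := by
  have hn0 : (0 : ℝ) < n := by exact_mod_cast (by omega : 0 < n)
  have hM0 : 0 < M := hc.trans_le hM
  set T := Finset.Ioo (i - n) (i + 1 + n) with hT
  have h1 := h.eq i T (Finset.Ioo_subset_Ioo_right (by omega))
  have h2 := h.eq (i + 1) T (Finset.Ioo_subset_Ioo_left (by omega))
  have h3 : M * |φ (i + 1) - φ i| ≤ 3 * L * (1 / n) := by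
    calc M * |φ (i + 1) - φ i| = |M * φ (i + 1) - M * φ i| := by
          rw [← mul_sub, abs_mul, abs_of_pos hM0]
      _ = 1 / n * |∑ j ∈ T, (K (((i + 1 : ℤ) - j) / n) - K ((i - j) / n)) * φ j ^ p| := by
          rw [h1, h2, ← mul_sub, ← Finset.sum_sub_distrib, abs_mul, abs_of_nonneg (by positivity)]
          simp only [sub_mul]
      _ ≤ 1 / n * ∑ j ∈ T, L * (1 / n) * φ j ^ p := by
          gcongr
          refine (Finset.abs_sum_le_sum_abs _ _).trans (Finset.sum_le_sum fun j _ => ?_)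
          rw [abs_mul, abs_of_nonneg (Real.rpow_nonneg (h.nonneg j) p)]
          refine mul_le_mul_of_nonneg_right ?_ (Real.rpow_nonneg (h.nonneg j) p)
          refine (hK.lip _ _).trans (le_of_eq ?_)
          congr 1
          rw [← sub_div, abs_div, Nat.abs_cast]
          push_cast
          congr 1
          rw [show (i : ℝ) + 1 - j - (i - j) = 1 by ring, abs_one]
      _ = L * (1 / n) * (1 / n * ∑ j ∈ T, φ j ^ p) := by rw [← Finset.mul_sum]; ring
      _ ≤ L * (1 / n) * 3 := by
          have := hK.lip_pos
          exact mul_le_mul_of_nonneg_left (h.sum_rpow_le hp hn i) (by positivity)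
      _ = 3 * L * (1 / n) := by ring
  rw [div_mul_eq_mul_div, le_div_iff₀ hc, mul_comm]
  exact (mul_le_mul_of_nonneg_right hM (abs_nonneg _)).trans h3

lemma abs_sub_le (h : LatticeSolution K p n M φ) (hK : BumpKernel K L) (hp : 1 < p)
    (hn : 2 ≤ n) {c : ℝ} (hc : 0 < c) (hM : c ≤ M) (i j : ℤ) :
    |φ i - φ j| ≤ 3 * L / c * (|(i : ℝ) - j| / n) := by
  have key : ∀ (i : ℤ) (k : ℕ), |φ (i + k) - φ i| ≤ 3 * L / c * (k / n) := by
    intro i k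
    induction k with
    | zero => simp
    | succ k ih =>
      have h1 := h.abs_sub_succ_le hK hp hn hc hM (i + k)
      have h2 := _root_.abs_sub_le (φ (i + (k + 1 : ℕ))) (φ (i + k)) (φ i)
      have h3 : i + ((k + 1 : ℕ) : ℤ) = i + k + 1 := by push_cast; ring
      rw [h3] at h2 ⊢
      calc _ ≤ _ := h2
        _ ≤ 3 * L / c * (1 / n) + 3 * L / c * (k / n) := add_le_add h1 ih
        _ = _ := by push_cast; ring
  rcases le_total i j with hij | hij
  · obtain ⟨k, rfl⟩ := Int.le.dest hij
    have := key i k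
    rw [abs_sub_comm]
    push_cast
    rwa [show (i : ℝ) - (i + k) = -k by ring, abs_neg, Nat.abs_cast]
  · obtain ⟨k, rfl⟩ := Int.le.dest hij
    have := key j k
    push_cast
    rwa [show (j : ℝ) + k - j = k by ring, Nat.abs_cast]

/-- Since the equation is superlinear, its solutions cannot be uniformly small. -/
lemma le_rpow_zero (h : LatticeSolution K p n M φ) (hK : BumpKernel K L) (hp : 1 < p)
    (hn : 2 ≤ n) : M ≤ 2 * L * φ 0 ^ (p - 1) := by
  have hn0 : (0 : ℝ) < n := by exact_mod_cast (by omega : 0 < n)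
  have h0 := h.zero_pos hp hn
  have hL := hK.lip_pos
  have h1 := h.eq 0 (Finset.Ioo (0 - n) (0 + n)) subset_rfl
  have h2 : M * φ 0 ≤ 2 * L * φ 0 ^ p := by
    rw [h1]
    calc _ ≤ 1 / (n : ℝ) * ∑ j ∈ Finset.Ioo (0 - (n : ℤ)) (0 + n), L * φ 0 ^ p := by
          gcongr with j _
          · exact Real.rpow_nonneg (h.nonneg j) _
          · exact hK.le_lip _
          · exact h.nonneg j
          · exact h.le_zero j
      _ = 1 / (n : ℝ) * ((Finset.Ioo (0 - (n : ℤ)) (0 + n)).card * (L * φ 0 ^ p)) := by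
          rw [Finset.sum_const, nsmul_eq_mul]
      _ ≤ 1 / (n : ℝ) * ((2 * n : ℕ) * (L * φ 0 ^ p)) := by
          gcongr
          rw [Int.card_Ioo]; omega
      _ = 2 * L * φ 0 ^ p := by push_cast; field_simp
  rw [Real.rpow_sub_one h0.ne', ← mul_div_assoc, le_div_iff₀ h0]
  exact h2

end LatticeSolution

lemma intervalIntegrable_floor {g : ℤ → ℝ} {B : ℝ} (hg : ∀ i, |g i| ≤ B) (n : ℕ) (a b : ℝ) :
    IntervalIntegrable (fun y : ℝ => g ⌊n * y⌋) volume a b := by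
  have hm : Measurable fun y : ℝ => g ⌊n * y⌋ :=
    (measurable_of_countable g).comp (Int.measurable_floor.comp (measurable_const_mul _))
  refine (intervalIntegrable_const (c := B)).mono_fun hm.aestronglyMeasurable ?_
  refine Filter.Eventually.of_forall fun y => ?_
  exact (hg _).trans (le_abs_self B)

lemma integral_floor {g : ℤ → ℝ} {B : ℝ} (hg : ∀ i, |g i| ≤ B) {n : ℕ} (hn : 0 < n) {a b : ℤ}
    (hab : a ≤ b) :
    ∫ y in (a / n : ℝ)..(b / n), g ⌊n * y⌋ = 1 / n * ∑ j ∈ Finset.Ico a b, g j := by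
  have hn0 : (0 : ℝ) < n := by exact_mod_cast hn
  induction b, hab using Int.leInduction with
  | base => simp
  | succ b hab ih =>
    have h1 : ∫ y in (b / n : ℝ)..((b + 1 : ℤ) / n), g ⌊n * y⌋ = 1 / n * g b := by
      have h2 : ∫ y in (b / n : ℝ)..((b + 1 : ℤ) / n), g ⌊n * y⌋ =
          ∫ y in (b / n : ℝ)..((b + 1 : ℤ) / n), g b := by
        have hle : (b / n : ℝ) ≤ (b + 1 : ℤ) / n := by gcongr; linarith
        rw [intervalIntegral.integral_of_le hle, intervalIntegral.integral_of_le hle,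
          integral_Ioc_eq_integral_Ioo, integral_Ioc_eq_integral_Ioo]
        refine setIntegral_congr_fun measurableSet_Ioo fun y hy => ?_
        refine congr_arg g (Int.floor_eq_iff.2 ?_)
        have h3 := hy.1
        have h4 := hy.2
        rw [div_lt_iff₀ hn0] at h3
        rw [lt_div_iff₀ hn0] at h4
        push_cast at h4
        constructor <;> linarith
      rw [h2, intervalIntegral.integral_const, smul_eq_mul]
      push_cast
      ring
    rw [← intervalIntegral.integral_add_adjacent_intervals
      (intervalIntegrable_floor hg n _ (b / n : ℝ)) (intervalIntegrable_floor hg n _ _), ih, h1,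
      ← Finset.insert_Ico_right_eq_Ico_add_one hab, Finset.sum_insert (by simp)]
    ring

/-- The step function of a lattice solution solves an integral equation on the line. -/
lemma LatticeSolution.integral_eq {K : ℝ → ℝ} {L p M : ℝ} {n : ℕ} {φ : ℤ → ℝ}
    (h : LatticeSolution K p n M φ) (hK : BumpKernel K L) (hp : 1 < p) (hn : 2 ≤ n) (x : ℝ) :
    M * φ ⌊n * x⌋ = ∫ y : ℝ, K ((⌊n * x⌋ - ⌊n * y⌋) / n) * φ ⌊n * y⌋ ^ p := by
  have hn0 : (0 : ℝ) < n := by exact_mod_cast (by omega : 0 < n)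
  set i := ⌊n * x⌋ with hi
  rw [h.eq i (Finset.Ico (i - n) (i + n)) Finset.Ioo_subset_Ico_self,
    ← integral_floor (g := fun j : ℤ => K ((i - j) / n) * φ j ^ p) (B := L * φ 0 ^ p)
      (fun j => ?_) (by omega) (by omega)]
  · rw [intervalIntegral.integral_of_le (by gcongr; omega)]
    refine setIntegral_eq_integral_of_forall_compl_eq_zero fun y hy => ?_
    rw [hK.vanish, zero_mul]
    rw [Set.mem_Ioc, not_and_or, not_lt, not_le, le_div_iff₀ hn0, div_lt_iff₀ hn0] at hy
    rw [abs_div, Nat.abs_cast, le_div_iff₀ hn0, one_mul, le_abs]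
    rcases hy with hy | hy
    · left
      have h1 : (⌊n * y⌋ : ℝ) ≤ n * y := Int.floor_le _
      push_cast at hy
      linarith
    · right
      have h1 : i + n ≤ ⌊n * y⌋ := Int.le_floor.2 (by rw [mul_comm (n : ℝ) y]; exact hy.le)
      have h2 : ((i + n : ℤ) : ℝ) ≤ ⌊n * y⌋ := by exact_mod_cast h1
      push_cast at h2
      linarith
  · rw [abs_mul, abs_of_nonneg (hK.nonneg _), abs_of_nonneg (Real.rpow_nonneg (h.nonneg j) _)]
    have := h.nonneg j
    have := hK.lip_pos
    have := h.le_zero j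
    gcongr
    exact hK.le_lip _

/-! ### Passage to the limit of vanishing mesh and infinite period -/

/-- A version of the Arzelà--Ascoli theorem for functions, such as step functions, that are
Lipschitz only up to a vanishing error. The limit is pointwise. -/
lemma exists_subseq_tendsto {f : ℕ → ℝ → ℝ} {B C : ℝ} {e : ℕ → ℝ} (hC : 0 ≤ C)
    (hf : ∀ n x, f n x ∈ Icc 0 B) (hlip : ∀ n x y, |f n x - f n y| ≤ C * (|x - y| + e n))
    (he : Filter.Tendsto e Filter.atTop (nhds 0)) :
    ∃ ψ : ℕ → ℕ, StrictMono ψ ∧ ∃ F : ℝ → ℝ, ∀ x,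
      Filter.Tendsto (fun n => f (ψ n) x) Filter.atTop (nhds (F x)) := by
  have hcomp : IsCompact (Set.univ.pi fun _ : ℚ => Icc (0 : ℝ) B) :=
    isCompact_univ_pi fun _ => isCompact_Icc
  obtain ⟨G, -, ψ, hψ, hG⟩ := hcomp.tendsto_subseq
    (x := fun n (r : ℚ) => f n r) (fun n r _ => hf n r)
  rw [tendsto_pi_nhds] at hG
  have hcauchy : ∀ x, CauchySeq fun n => f (ψ n) x := by
    intro x
    rw [Metric.cauchySeq_iff']
    intro ε hε
    set η := ε / (5 * (C + 1)) with hη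
    have hη0 : 0 < η := by positivity
    have hCη : C * η ≤ ε / 5 := by
      rw [hη, ← mul_div_assoc, div_le_div_iff₀ (by positivity) (by positivity)]
      nlinarith
    obtain ⟨r, hr⟩ := exists_rat_btwn (show x < x + η by linarith)
    have hxr : |x - r| ≤ η := by rw [abs_le]; constructor <;> linarith [hr.1, hr.2]
    have h1 := (Metric.cauchySeq_iff.1 (hG r).cauchySeq) (ε / 5) (by positivity)
    obtain ⟨N₁, hN₁⟩ := h1
    have h2 : ∀ᶠ n in Filter.atTop, e (ψ n) < η :=
      (he.comp hψ.tendsto_atTop).eventually (gt_mem_nhds hη0)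
    obtain ⟨N₂, hN₂⟩ := Filter.eventually_atTop.1 h2
    have hnear : ∀ n ≥ N₂, |f (ψ n) x - f (ψ n) r| ≤ 2 * (ε / 5) := by
      intro n hn
      refine (hlip (ψ n) x r).trans ?_
      have : C * (|x - r| + e (ψ n)) ≤ C * (η + η) := by
        have := (hN₂ n hn).le
        gcongr
      linarith
    refine ⟨max N₁ N₂, fun n hn => ?_⟩
    have hn1 : N₁ ≤ n := (le_max_left _ _).trans hn
    have hn2 : N₂ ≤ n := (le_max_right _ _).trans hn
    have h3 := hN₁ n hn1 (max N₁ N₂) (le_max_left _ _)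
    have h4 := hnear n hn2
    have h5 := hnear (max N₁ N₂) (le_max_right _ _)
    simp only [Function.comp_apply, Real.dist_eq] at h3
    rw [Real.dist_eq]
    rw [abs_le] at h4 h5
    rw [abs_lt] at h3 ⊢
    constructor <;> linarith [h3.1, h3.2, h4.1, h4.2, h5.1, h5.2]
  choose F hF using fun x => cauchySeq_tendsto_of_complete (hcauchy x)
  exact ⟨ψ, hψ, F, hF⟩

lemma abs_floor_sub_floor_le {n : ℕ} (hn : 0 < n) (x y : ℝ) :
    |((⌊n * x⌋ : ℝ) - ⌊n * y⌋) / n - (x - y)| ≤ 1 / n := by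
  have hn0 : (0 : ℝ) < n := by exact_mod_cast hn
  have h1 := Int.floor_le (n * x)
  have h2 := Int.lt_floor_add_one (n * x)
  have h3 := Int.floor_le (n * y)
  have h4 := Int.lt_floor_add_one (n * y)
  rw [show ((⌊n * x⌋ : ℝ) - ⌊n * y⌋) / n - (x - y) =
    ((⌊n * x⌋ - n * x) - (⌊n * y⌋ - n * y)) / n by field_simp; ring, abs_div, Nat.abs_cast]
  gcongr
  rw [abs_le]
  constructor <;> linarith

/-- Existence of a nonzero solution of `M Φ = K * Φ ^ p` of finite energy. The bound on the energy
and the value at the maximum, both uniform in the mesh, survive the limit; whether the limit is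
again a maximiser plays no role. -/
theorem exists_solution {K : ℝ → ℝ} {L : ℝ} (hK : BumpKernel K L) {p : ℝ} (hp : 1 < p) :
    ∃ M > 0, ∃ (Φ : ℝ → ℝ) (C : ℝ), (∀ x, 0 ≤ Φ x) ∧ 0 < Φ 0 ∧ (∀ x, Φ x ≤ Φ 0) ∧
      (∀ x y, |Φ x - Φ y| ≤ C * |x - y|) ∧ Integrable (fun x => Φ x ^ (p + 1)) ∧
      (∀ x, M * Φ x = ∫ y, K (x - y) * Φ y ^ p) ∧
      (AntitoneOn K (Ici 0) → Function.Even Φ ∧ AntitoneOn Φ (Ici 0)) := by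
  obtain ⟨c, hc, H⟩ := exists_latticeSolution hK hp
  have hp0 : 0 < p := by linarith
  have hL := hK.lip_pos
  choose M₀ hM₀ φ₀ hφ₀ hbell₀ using fun n : ℕ => H (n + 2) (by omega)
  set B := 3 * L / c with hB
  have hB0 : 0 < B := by positivity
  have hMB : ∀ n, M₀ n ≤ 2 * L * B ^ (p - 1) := by
    intro n
    refine ((hφ₀ n).le_rpow_zero hK hp (by omega)).trans ?_
    have h0 := (hφ₀ n).nonneg 0
    have := (hφ₀ n).le_bound hK hp (by omega) hc (hM₀ n) 0
    gcongr
  obtain ⟨M, hM, ψ₁, hψ₁, hM₁⟩ := (isCompact_Icc (a := c) (b := 2 * L * B ^ (p - 1))).tendsto_subseq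
    (x := M₀) fun n => ⟨hM₀ n, hMB n⟩
  have he : Filter.Tendsto (fun n => 1 / ((ψ₁ n + 2 : ℕ) : ℝ)) Filter.atTop (nhds 0) := by
    refine tendsto_one_div_atTop_nhds_zero_nat.comp ?_
    exact Filter.tendsto_atTop_mono (fun n => by
      have := hψ₁.le_apply (x := n)
      show n ≤ _
      omega)
      Filter.tendsto_id
  obtain ⟨ψ₂, hψ₂, Φ, hΦ⟩ := exists_subseq_tendsto (B := B) (C := B)
    (f := fun n x => φ₀ (ψ₁ n) ⌊((ψ₁ n + 2 : ℕ) : ℝ) * x⌋)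
    (e := fun n => 1 / ((ψ₁ n + 2 : ℕ) : ℝ)) hB0.le
    (fun n x => ⟨(hφ₀ _).nonneg _, (hφ₀ _).le_bound hK hp (by omega) hc (hM₀ _) _⟩)
    (fun n x y => by
      refine ((hφ₀ (ψ₁ n)).abs_sub_le hK hp (by omega) hc (hM₀ _) _ _).trans ?_
      refine mul_le_mul_of_nonneg_left ?_ hB0.le
      have h1 := abs_floor_sub_floor_le (n := ψ₁ n + 2) (by omega) x y
      rw [← Nat.abs_cast (ψ₁ n + 2), ← abs_div, Nat.abs_cast]
      have h2 := abs_sub_abs_le_abs_sub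
        (((⌊((ψ₁ n + 2 : ℕ) : ℝ) * x⌋ : ℝ) - ⌊((ψ₁ n + 2 : ℕ) : ℝ) * y⌋) / ((ψ₁ n + 2 : ℕ) : ℝ))
        (x - y)
      linarith) he
  -- from here on, `N n` is the inverse mesh and `φ n` the lattice solution along the subsequence
  set N : ℕ → ℕ := fun n => ψ₁ (ψ₂ n) + 2 with hN
  set φ : ℕ → ℤ → ℝ := fun n => φ₀ (ψ₁ (ψ₂ n)) with hφdef
  set μ : ℕ → ℝ := fun n => M₀ (ψ₁ (ψ₂ n)) with hμdef
  have hsol : ∀ n, LatticeSolution K p (N n) (μ n) (φ n) := fun n => hφ₀ _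
  have hN2 : ∀ n, 2 ≤ N n := fun n => by simp only [hN]; omega
  have hN0 : ∀ n, (0 : ℝ) < N n := fun n => by
    have := hN2 n
    exact_mod_cast (by omega : 0 < N n)
  have hNn : ∀ n, n ≤ N n := fun n => by
    have h1 := (hψ₁.comp hψ₂).le_apply (x := n)
    simp only [Function.comp_apply] at h1
    simp only [hN]; omega
  have hNinv : Filter.Tendsto (fun n => 1 / (N n : ℝ)) Filter.atTop (nhds 0) :=
    he.comp hψ₂.tendsto_atTop
  have hμ : Filter.Tendsto μ Filter.atTop (nhds M) := hM₁.comp hψ₂.tendsto_atTop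
  have hμc : ∀ n, c ≤ μ n := fun n => hM₀ _
  have hφB : ∀ n i, φ n i ≤ B := fun n i => (hsol n).le_bound hK hp (hN2 n) hc (hμc n) i
  replace hΦ : ∀ x : ℝ, Filter.Tendsto (fun n => φ n ⌊N n * x⌋) Filter.atTop (nhds (Φ x)) := hΦ
  have hΦ0 : ∀ x, 0 ≤ Φ x := fun x => ge_of_tendsto' (hΦ x) fun n => (hsol n).nonneg _
  have hfl : ∀ n (x y : ℝ), |φ n ⌊N n * x⌋ - φ n ⌊N n * y⌋| ≤ B * (|x - y| + 1 / N n) := by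
    intro n x y
    refine ((hsol n).abs_sub_le hK hp (hN2 n) hc (hμc n) _ _).trans ?_
    refine mul_le_mul_of_nonneg_left ?_ hB0.le
    have h1 := abs_floor_sub_floor_le (n := N n) (by have := hN2 n; omega) x y
    rw [← Nat.abs_cast (N n), ← abs_div, Nat.abs_cast]
    have h2 := abs_sub_abs_le_abs_sub (((⌊N n * x⌋ : ℝ) - ⌊N n * y⌋) / N n) (x - y)
    linarith
  have hlip : ∀ x y, |Φ x - Φ y| ≤ B * |x - y| := by
    intro x y
    have h1 : Filter.Tendsto (fun n => B * (|x - y| + 1 / (N n : ℝ))) Filter.atTop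
        (nhds (B * (|x - y| + 0))) := (hNinv.const_add _).const_mul _
    rw [add_zero] at h1
    exact le_of_tendsto_of_tendsto' ((hΦ x).sub (hΦ y)).abs h1 fun n => hfl n x y
  have hmeas : ∀ n, Measurable fun y : ℝ => φ n ⌊N n * y⌋ := fun n =>
    (measurable_of_countable _).comp (Int.measurable_floor.comp (measurable_const_mul _))
  have hpowB : ∀ n i, φ n i ^ p ≤ B ^ p := fun n i =>
    Real.rpow_le_rpow ((hsol n).nonneg i) (hφB n i) hp0.le
  refine ⟨M, hc.trans_le hM.1, Φ, B, hΦ0, ?_, ?_, hlip, ?_, ?_, ?_⟩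
  · -- the values at the origin are bounded below
    have h1 : ∀ n, (c / (2 * L)) ≤ φ n ⌊N n * (0 : ℝ)⌋ ^ (p - 1) := by
      intro n
      rw [mul_zero, Int.floor_zero, div_le_iff₀ (by positivity), mul_comm]
      exact (hμc n).trans ((hsol n).le_rpow_zero hK hp (hN2 n))
    have h2 : c / (2 * L) ≤ Φ 0 ^ (p - 1) :=
      ge_of_tendsto' ((hΦ 0).rpow_const (Or.inr (by linarith))) h1
    refine lt_of_le_of_ne (hΦ0 0) fun h0 => ?_
    rw [← h0, Real.zero_rpow (by linarith)] at h2
    have : 0 < c / (2 * L) := by positivity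
    linarith
  · intro x
    refine le_of_tendsto_of_tendsto' (hΦ x) (hΦ 0) fun n => ?_
    rw [mul_zero, Int.floor_zero]
    exact (hsol n).le_zero _
  · have hcont : Continuous Φ := (LipschitzWith.of_dist_le_mul (K := B.toNNReal) fun x y => by
      rw [Real.dist_eq, Real.dist_eq, Real.coe_toNNReal _ hB0.le]; exact hlip x y).continuous
    have hcont' : Continuous fun x => Φ x ^ (p + 1) :=
      hcont.rpow_const fun x => Or.inr (by linarith)
    have henergy : ∀ n, ∫ y in (-(N n) : ℝ)..(N n), φ n ⌊N n * y⌋ ^ (p + 1) = 1 := by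
      intro n
      have h1 := integral_floor (g := fun j => φ n j ^ (p + 1)) (B := B ^ (p + 1)) (n := N n)
        (fun i => by
          rw [abs_of_nonneg (Real.rpow_nonneg ((hsol n).nonneg i) _)]
          exact Real.rpow_le_rpow ((hsol n).nonneg i) (hφB n i) (by linarith))
        (by have := hN2 n; omega) (a := -(N n : ℤ) ^ 2) (b := -(N n : ℤ) ^ 2 + 2 * (N n) ^ 2)
        (by nlinarith)
      rw [(hsol n).energy] at h1
      have hne := (hN0 n).ne'
      convert h1 using 2
      · push_cast; field_simp
      · push_cast; field_simp; ring
      · field_simp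
    refine integrable_of_intervalIntegral_norm_bounded (l := Filter.atTop) (a := fun n : ℕ => -(n : ℝ))
      (b := fun n : ℕ => (n : ℝ)) 1
      (fun n => (hcont'.integrableOn_Icc).mono_set Ioc_subset_Icc_self)
      (Filter.tendsto_neg_atTop_atBot.comp tendsto_natCast_atTop_atTop)
      tendsto_natCast_atTop_atTop (Filter.Eventually.of_forall fun R => ?_)
    have hR : (-(R : ℝ)) ≤ R := by linarith [Nat.cast_nonneg (α := ℝ) R]
    simp_rw [Real.norm_of_nonneg (Real.rpow_nonneg (hΦ0 _) _)]
    have hlim : Filter.Tendsto (fun n => ∫ y in (-(R : ℝ))..R, φ n ⌊N n * y⌋ ^ (p + 1))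
        Filter.atTop (nhds (∫ y in (-(R : ℝ))..R, Φ y ^ (p + 1))) := by
      refine intervalIntegral.tendsto_integral_filter_of_dominated_convergence
        (fun _ => B ^ (p + 1)) (Filter.Eventually.of_forall fun n =>
          ((hmeas n).pow_const _).aestronglyMeasurable)
        (Filter.Eventually.of_forall fun n => Filter.Eventually.of_forall fun y _ => ?_)
        intervalIntegrable_const (Filter.Eventually.of_forall fun y _ =>
          (hΦ y).rpow_const (Or.inr (by linarith)))
      rw [Real.norm_of_nonneg (Real.rpow_nonneg ((hsol n).nonneg _) _)]
      exact Real.rpow_le_rpow ((hsol n).nonneg _) (hφB n _) (by linarith)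
    refine le_of_tendsto hlim ?_
    filter_upwards [Filter.eventually_ge_atTop R] with n hn
    refine le_of_le_of_eq ?_ (henergy n)
    have hRN : (R : ℝ) ≤ N n := by exact_mod_cast hn.trans (hNn n)
    refine intervalIntegral.integral_mono_interval (neg_le_neg hRN) hR hRN
      (Filter.Eventually.of_forall fun y => Real.rpow_nonneg ((hsol n).nonneg _) _) ?_
    exact intervalIntegrable_floor (g := fun j => φ n j ^ (p + 1)) (B := B ^ (p + 1))
      (fun i => by
        rw [abs_of_nonneg (Real.rpow_nonneg ((hsol n).nonneg i) _)]
        exact Real.rpow_le_rpow ((hsol n).nonneg i) (hφB n i) (by linarith)) (N n) _ _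
  · intro x
    have h1 : Filter.Tendsto (fun n => μ n * φ n ⌊N n * x⌋) Filter.atTop (nhds (M * Φ x)) :=
      hμ.mul (hΦ x)
    refine tendsto_nhds_unique h1 ?_
    simp_rw [fun n => (hsol n).integral_eq hK hp (hN2 n) x]
    refine tendsto_integral_of_dominated_convergence
      ((Icc (x - 2) (x + 2)).indicator fun _ => L * B ^ p) (fun n => ?_) ?_ (fun n => ?_) ?_
    · refine Measurable.aestronglyMeasurable (Measurable.mul ?_ ((hmeas n).pow_const _))
      exact (measurable_of_countable fun i : ℤ => K ((⌊N n * x⌋ - i) / N n)).comp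
        (Int.measurable_floor.comp (measurable_const_mul _))
    · exact (integrable_indicator_iff measurableSet_Icc).2
        (continuous_const.integrableOn_Icc)
    · refine Filter.Eventually.of_forall fun y => ?_
      rw [Real.norm_of_nonneg (mul_nonneg (hK.nonneg _) (Real.rpow_nonneg ((hsol n).nonneg _) _))]
      by_cases hy : y ∈ Icc (x - 2) (x + 2)
      · rw [Set.indicator_of_mem hy]
        exact mul_le_mul (hK.le_lip _) (hpowB n _) (Real.rpow_nonneg ((hsol n).nonneg _) _) hL.le
      · rw [Set.indicator_of_notMem hy, hK.vanish, zero_mul]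
        have h2 := abs_floor_sub_floor_le (n := N n) (by have := hN2 n; omega) x y
        have h3 : 2 ≤ |x - y| := by
          rw [Set.mem_Icc, not_and_or, not_le, not_le] at hy
          rw [le_abs]
          rcases hy with hy | hy
          · left; linarith
          · right; linarith
        have h4 : 1 / (N n : ℝ) ≤ 1 := by
          rw [div_le_one (hN0 n)]
          exact_mod_cast (by have := hN2 n; omega : 1 ≤ N n)
        have h5 := abs_sub_abs_le_abs_sub (x - y) (((⌊N n * x⌋ : ℝ) - ⌊N n * y⌋) / N n)
        rw [abs_sub_comm] at h2
        linarith
    · refine Filter.Eventually.of_forall fun y => Filter.Tendsto.mul ?_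
        ((hΦ y).rpow_const (Or.inr hp0.le))
      refine (hK.continuous.tendsto _).comp ?_
      rw [tendsto_iff_norm_sub_tendsto_zero]
      exact squeeze_zero (fun n => norm_nonneg _)
        (fun n => abs_floor_sub_floor_le (by have := hN2 n; omega) x y) hNinv
  · intro hanti
    have hbell : ∀ n, (∀ i, φ n (-i) = φ n i) ∧ ∀ i j : ℤ, i.natAbs ≤ j.natAbs →
        j.natAbs ≤ N n ^ 2 → φ n j ≤ φ n i := fun n => hbell₀ _ hanti
    constructor
    · intro x
      have h1 : Filter.Tendsto (fun n => φ n ⌊N n * (-x)⌋ - φ n ⌊N n * x⌋) Filter.atTop (nhds 0) := by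
        rw [tendsto_zero_iff_abs_tendsto_zero]
        have hB1 : Filter.Tendsto (fun n => B * (1 / (N n : ℝ))) Filter.atTop (nhds 0) := by
          have := hNinv.const_mul B
          rwa [mul_zero] at this
        refine squeeze_zero (fun n => abs_nonneg _) (fun n => ?_) hB1
        show |φ n ⌊N n * (-x)⌋ - φ n ⌊N n * x⌋| ≤ B * (1 / N n)
        rw [mul_neg, Int.floor_neg, (hbell n).1]
        refine ((hsol n).abs_sub_le hK hp (hN2 n) hc (hμc n) _ _).trans ?_
        have h2 := Int.ceil_le_floor_add_one (N n * x)
        have h3 := Int.floor_le_ceil (N n * x)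
        have h4 : |((⌈N n * x⌉ : ℝ) - ⌊N n * x⌋)| ≤ 1 := by
          rw [abs_le]
          have h5 : (⌈N n * x⌉ : ℝ) ≤ ⌊N n * x⌋ + 1 := by exact_mod_cast h2
          have h6 : (⌊N n * x⌋ : ℝ) ≤ ⌈N n * x⌉ := by exact_mod_cast h3
          constructor <;> linarith
        gcongr
      have h2 := tendsto_nhds_unique h1 ((hΦ (-x)).sub (hΦ x))
      linarith
    · intro x hx y hy hxy
      rw [Set.mem_Ici] at hx hy
      refine le_of_tendsto_of_tendsto (hΦ y) (hΦ x) ?_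
      filter_upwards [Filter.eventually_ge_atTop ⌈y⌉₊] with n hn
      have h1 : 0 ≤ ⌊N n * x⌋ := Int.floor_nonneg.2 (by have := hN0 n; positivity)
      have h2 : ⌊N n * x⌋ ≤ ⌊N n * y⌋ := Int.floor_le_floor (by have := hN0 n; gcongr)
      have h3 : ⌊N n * y⌋ ≤ (N n : ℤ) ^ 2 := by
        have h4 : y ≤ N n := (Nat.le_ceil y).trans (by exact_mod_cast hn.trans (hNn n))
        have h5 : (⌊N n * y⌋ : ℝ) ≤ N n * N n :=
          (Int.floor_le _).trans (by have := hN0 n; gcongr)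
        have h6 : ⌊N n * y⌋ ≤ (N n : ℤ) * N n := by exact_mod_cast h5
        linarith [sq (N n : ℤ)]
      refine (hbell n).2 _ _ (by omega) ?_
      zify
      rw [abs_of_nonneg (by omega)]
      exact h3

/-! ### Positivity, decay and strict monotonicity of solutions -/

/-- A nonnegative Lipschitz function with an integrable power vanishes at infinity. -/
lemma tendsto_zero_of_integrable_rpow {F : ℝ → ℝ} {C r : ℝ} (hr : 0 < r) (hF : ∀ x, 0 ≤ F x)
    (hlip : ∀ x y, |F x - F y| ≤ C * |x - y|) (hint : Integrable fun x => F x ^ r) :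
    Filter.Tendsto F Filter.atTop (nhds 0) := by
  rw [Metric.tendsto_nhds]
  intro ε hε
  set C' := |C| + 1 with hC'
  have hC'0 : 0 < C' := by positivity
  set η := ε / (2 * C') with hη
  have hη0 : 0 < η := by positivity
  have hI := intervalIntegral_tendsto_integral_Ioi 0 hint.integrableOn Filter.tendsto_id
  simp only [id] at hI
  have h1 : Filter.Tendsto (fun x => (∫ y in (0 : ℝ)..(x + η), F y ^ r) - ∫ y in (0 : ℝ)..x, F y ^ r)
      Filter.atTop (nhds 0) := by
    have := (hI.comp (Filter.tendsto_atTop_add_const_right _ η Filter.tendsto_id)).sub hI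
    rwa [sub_self] at this
  have hpos : 0 < η * (ε / 2) ^ r := by positivity
  filter_upwards [h1.eventually (gt_mem_nhds hpos)] with x hx
  rw [Real.dist_eq, sub_zero, abs_of_nonneg (hF x)]
  by_contra! hlt
  have hii : ∀ a b, IntervalIntegrable (fun y => F y ^ r) volume a b := fun a b =>
    hint.intervalIntegrable
  rw [intervalIntegral.integral_interval_sub_left (hii _ _) (hii _ _)] at hx
  have h2 : ∫ _ in x..(x + η), (ε / 2) ^ r ≤ ∫ y in x..(x + η), F y ^ r := by
    refine intervalIntegral.integral_mono_on (by linarith) intervalIntegrable_const (hii _ _) ?_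
    intro y hy
    refine Real.rpow_le_rpow (by positivity) ?_ hr.le
    have h3 := hlip x y
    have h4 : |x - y| ≤ η := by rw [abs_le]; constructor <;> linarith [hy.1, hy.2]
    have h5 : C * |x - y| ≤ C' * η := by
      have : C ≤ C' := by rw [hC']; linarith [le_abs_self C]
      gcongr
    have h6 : C' * η = ε / 2 := by rw [hη]; field_simp
    have := le_abs_self (F x - F y)
    linarith
  rw [intervalIntegral.integral_const, smul_eq_mul] at h2
  linarith

section Profile

variable {K : ℝ → ℝ} {L p κ : ℝ} {Φ : ℝ → ℝ}

lemma BumpKernel.eq_zero_of_notMem (hK : BumpKernel K L) {x y : ℝ} (hy : y ∉ Icc (x - 1) (x + 1)) :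
    K (x - y) = 0 := by
  refine hK.vanish _ ?_
  rw [Set.mem_Icc, not_and_or, not_le, not_le] at hy
  rw [le_abs]
  rcases hy with hy | hy
  · left; linarith
  · right; linarith

lemma BumpKernel.hasCompactSupport_mul (hK : BumpKernel K L) (x : ℝ) (f : ℝ → ℝ) :
    HasCompactSupport fun y => K (x - y) * f y :=
  HasCompactSupport.intro (isCompact_Icc (a := x - 1) (b := x + 1)) fun y hy => by
    rw [hK.eq_zero_of_notMem hy, zero_mul]

lemma BumpKernel.integrable_mul (hK : BumpKernel K L) (x : ℝ) {f : ℝ → ℝ} (hf : Continuous f) :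
    Integrable fun y => K (x - y) * f y :=
  ((hK.continuous.comp (continuous_const.sub continuous_id)).mul hf).integrable_of_hasCompactSupport
    (hK.hasCompactSupport_mul x f)

/-- Since the kernel has support `[-1, 1]`, the size of a solution at `x` is controlled by its size
on `[x - 1, x + 1]`. -/
lemma mul_le_rpow_of_le (hK : BumpKernel K L) (hp : 1 < p) (hΦ : ∀ x, 0 ≤ Φ x)
    (heq : ∀ x, κ * Φ x = ∫ y, K (x - y) * Φ y ^ p) {x b : ℝ}
    (hb : ∀ y ∈ Icc (x - 1) (x + 1), Φ y ≤ b) : κ * Φ x ≤ 2 * L * b ^ p := by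
  have hL := hK.lip_pos
  rw [heq]
  calc ∫ y, K (x - y) * Φ y ^ p ≤ ∫ y, (Icc (x - 1) (x + 1)).indicator (fun _ => L * b ^ p) y := by
        refine integral_mono_of_nonneg (Filter.Eventually.of_forall fun y =>
          mul_nonneg (hK.nonneg _) (Real.rpow_nonneg (hΦ y) p)) ?_
          (Filter.Eventually.of_forall fun y => ?_)
        · exact (integrable_indicator_iff measurableSet_Icc).2 (continuous_const.integrableOn_Icc)
        · by_cases hy : y ∈ Icc (x - 1) (x + 1)
          · simp only [Set.indicator_of_mem hy]
            exact mul_le_mul (hK.le_lip _) (Real.rpow_le_rpow (hΦ y) (hb y hy) (by linarith))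
              (Real.rpow_nonneg (hΦ y) p) hL.le
          · simp only [Set.indicator_of_notMem hy]
            rw [hK.eq_zero_of_notMem hy, zero_mul]
    _ = 2 * L * b ^ p := by
        rw [integral_indicator measurableSet_Icc, setIntegral_const, smul_eq_mul,
          Real.volume_real_Icc_of_le (by linarith)]
        ring

/-- The superlinearity makes a solution that vanishes at infinity decay exponentially. -/
lemma integrableOn_Ioi_of_tendsto (hK : BumpKernel K L) (hp : 1 < p) (hκ : 0 < κ)
    (hΦ : ∀ x, 0 ≤ Φ x) (hc : Continuous Φ)
    (heq : ∀ x, κ * Φ x = ∫ y, K (x - y) * Φ y ^ p)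
    (hlim : Filter.Tendsto Φ Filter.atTop (nhds 0)) : IntegrableOn Φ (Ioi 0) := by
  have hL := hK.lip_pos
  set η := (κ / (4 * L)) ^ (1 / (p - 1)) with hη
  have hη0 : 0 < η := by positivity
  have hηp : η ^ (p - 1) = κ / (4 * L) := by
    rw [hη, ← Real.rpow_mul (by positivity), one_div_mul_cancel (by linarith), Real.rpow_one]
  obtain ⟨R, hR⟩ := Filter.eventually_atTop.1 (hlim.eventually (gt_mem_nhds hη0))
  have key : ∀ k : ℕ, ∀ x, R + k ≤ x → Φ x ≤ η * (1 / 2) ^ k := by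
    intro k
    induction k with
    | zero => intro x hx; simpa using (hR x (by simpa using hx)).le
    | succ k ih =>
      intro x hx
      push_cast at hx
      have h1 := mul_le_rpow_of_le hK hp hΦ heq (x := x) (b := η * (1 / 2) ^ k)
        fun y hy => ih y (by linarith [hy.1])
      set b := η * (1 / 2) ^ k with hb
      have hb0 : 0 < b := by positivity
      have hbη : b ≤ η := by
        rw [hb]
        exact mul_le_of_le_one_right hη0.le (pow_le_one₀ (by norm_num) (by norm_num))
      have h2 : b ^ p = b ^ (p - 1) * b := by
        rw [← Real.rpow_add_one hb0.ne', sub_add_cancel]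
      have h3 : b ^ (p - 1) ≤ κ / (4 * L) := by
        rw [← hηp]
        exact Real.rpow_le_rpow hb0.le hbη (by linarith)
      have h4 : κ * Φ x ≤ κ * (b / 2) := by
        calc κ * Φ x ≤ 2 * L * (b ^ (p - 1) * b) := by rw [← h2]; exact h1
          _ ≤ 2 * L * (κ / (4 * L) * b) := by gcongr
          _ = κ * (b / 2) := by field_simp; ring
      have h5 := le_of_mul_le_mul_left h4 hκ
      rw [pow_succ]
      linarith
  refine integrable_of_isBigO_exp_neg (b := Real.log 2) (Real.log_pos (by norm_num))
    hc.continuousOn ?_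
  refine Asymptotics.IsBigO.of_bound (η * Real.exp (Real.log 2 * (R + 1))) ?_
  filter_upwards [Filter.eventually_ge_atTop R] with x hx
  rw [Real.norm_of_nonneg (hΦ x), Real.norm_of_nonneg (Real.exp_pos _).le]
  have h1 : (⌊x - R⌋₊ : ℝ) ≤ x - R := Nat.floor_le (by linarith)
  have h2 : x - R < ⌊x - R⌋₊ + 1 := Nat.lt_floor_add_one _
  refine (key ⌊x - R⌋₊ x (by linarith)).trans ?_
  rw [mul_assoc, ← Real.exp_add]
  have h3 : ((1 : ℝ) / 2) ^ ⌊x - R⌋₊ = Real.exp (-(Real.log 2 * ⌊x - R⌋₊)) := by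
    rw [Real.exp_neg, mul_comm, Real.exp_nat_mul, Real.exp_log (by norm_num), one_div, inv_pow]
  rw [h3]
  gcongr
  have := Real.log_pos (by norm_num : (1 : ℝ) < 2)
  nlinarith

lemma profile_pos (hK : BumpKernel K L) (hp : 1 < p) (hκ : 0 < κ)
    (hΦ : ∀ x, 0 ≤ Φ x) (hc : Continuous Φ) (h0 : 0 < Φ 0)
    (heq : ∀ x, κ * Φ x = ∫ y, K (x - y) * Φ y ^ p) (x : ℝ) : 0 < Φ x := by
  obtain ⟨δ, hδ, hδK⟩ := Metric.eventually_nhds_iff.1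
    (hK.continuous.continuousAt.eventually (lt_mem_nhds hK.pos))
  have hcp : Continuous fun y => Φ y ^ p := hc.rpow_const fun y => Or.inr (by linarith)
  have hspread : ∀ x y, dist x y < δ → 0 < Φ y → 0 < Φ x := by
    intro x y hxy hy
    have h1 : 0 < ∫ y, K (x - y) * Φ y ^ p := by
      refine Continuous.integral_pos_of_hasCompactSupport_nonneg_nonzero (x := y)
        ((hK.continuous.comp (continuous_const.sub continuous_id)).mul hcp)
        (hK.hasCompactSupport_mul x _)
        (fun y => mul_nonneg (hK.nonneg _) (Real.rpow_nonneg (hΦ y) p)) ?_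
      have h2 : 0 < K (x - y) := hδK (by rwa [Real.dist_eq, sub_zero, ← Real.dist_eq])
      have h3 := Real.rpow_pos_of_pos hy p
      positivity
    rw [← heq] at h1
    exact pos_of_mul_pos_right h1 hκ.le
  have hclopen : IsClopen {x | 0 < Φ x} := by
    refine ⟨isClosed_of_closure_subset fun x hx => ?_, isOpen_lt continuous_const hc⟩
    obtain ⟨y, hy, hxy⟩ := Metric.mem_closure_iff.1 hx δ hδ
    exact hspread x y hxy hy
  exact Set.eq_univ_iff_forall.1 (hclopen.eq_univ ⟨0, h0⟩) x

/-- Positive integrable solutions of `κ Φ = K * Φ ^ p`, for every `κ > 0`: the equation is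
homogeneous of different degrees on the two sides, so that scaling adjusts the constant. -/
theorem exists_pos_solution (hK : BumpKernel K L) (hp : 1 < p) (hκ : 0 < κ) :
    ∃ Φ : ℝ → ℝ, (∀ x, 0 < Φ x) ∧ Continuous Φ ∧ Integrable Φ ∧ Integrable (fun x => Φ x ^ p) ∧
      (∀ x, Φ x ≤ Φ 0) ∧ Filter.Tendsto Φ Filter.atTop (nhds 0) ∧
      (∀ x, κ * Φ x = ∫ y, K (x - y) * Φ y ^ p) ∧
      (AntitoneOn K (Ici 0) → Function.Even Φ ∧ AntitoneOn Φ (Ici 0)) := by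
  obtain ⟨M, hM, Φ, C, hΦ, h0, hmax, hlip, hint, heq, hbell⟩ := exists_solution hK hp
  have hc : Continuous Φ := (LipschitzWith.of_dist_le_mul (K := C.toNNReal) fun x y => by
    rw [Real.dist_eq, Real.dist_eq]
    exact (hlip x y).trans (mul_le_mul_of_nonneg_right (Real.le_coe_toNNReal C) (abs_nonneg _))
    ).continuous
  have hlim := tendsto_zero_of_integrable_rpow (by linarith) hΦ hlip hint
  have hpos := profile_pos hK hp hM hΦ hc h0 heq
  have hneg : ∀ x, M * Φ (-x) = ∫ y, K (x - y) * Φ (-y) ^ p := by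
    intro x
    rw [heq, ← integral_neg_eq_self]
    congr 1
    ext y
    rw [← hK.even]
    congr 2; ring
  have hint1 := integrableOn_Ioi_of_tendsto hK hp hM hΦ hc heq hlim
  have hint2 := integrableOn_Ioi_of_tendsto hK hp hM (fun x => hΦ (-x)) (hc.comp continuous_neg)
    hneg (tendsto_zero_of_integrable_rpow (by linarith) (fun x => hΦ (-x))
      (fun x y => by
        refine (hlip (-x) (-y)).trans (le_of_eq ?_)
        rw [← abs_neg (x - y)]; congr 2; ring) hint.comp_neg)
  have hΦint : Integrable Φ := by
    have h3 : IntegrableOn Φ (Iic 0) := by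
      have h5 := (integrableOn_Ici_iff_integrableOn_Ioi (by simp)).2 hint2
      rw [← integrable_indicator_iff measurableSet_Ici] at h5
      rw [← integrable_indicator_iff measurableSet_Iic]
      refine h5.comp_neg.congr (Filter.Eventually.of_forall fun x => ?_)
      by_cases hx : x ≤ 0
      · simp [Set.indicator_of_mem, hx]
      · simp [Set.indicator_of_notMem, hx]
    rw [← integrableOn_univ, ← Set.Iic_union_Ioi (a := (0 : ℝ))]
    exact h3.union hint1
  have hcp : Continuous fun x => Φ x ^ p := hc.rpow_const fun x => Or.inr (by linarith)
  have hΦp : Integrable fun x => Φ x ^ p := by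
    refine (hΦint.const_mul (Φ 0 ^ (p - 1))).mono' hcp.aestronglyMeasurable
      (Filter.Eventually.of_forall fun x => ?_)
    rw [Real.norm_of_nonneg (Real.rpow_nonneg (hΦ x) _)]
    calc Φ x ^ p = Φ x ^ (p - 1) * Φ x := by
          rw [← Real.rpow_add_one (hpos x).ne', sub_add_cancel]
      _ ≤ Φ 0 ^ (p - 1) * Φ x :=
          mul_le_mul_of_nonneg_right (Real.rpow_le_rpow (hΦ x) (hmax x) (by linarith)) (hΦ x)
  set l := (κ / M) ^ (1 / (p - 1)) with hl
  have hl0 : 0 < l := by positivity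
  have hlp : l ^ (p - 1) = κ / M := by
    rw [hl, ← Real.rpow_mul (by positivity), one_div_mul_cancel (by linarith), Real.rpow_one]
  have hmul : ∀ x, (l * Φ x) ^ p = l ^ p * Φ x ^ p := fun x => Real.mul_rpow hl0.le (hΦ x)
  refine ⟨fun x => l * Φ x, fun x => mul_pos hl0 (hpos x), hc.const_mul l, hΦint.const_mul l, ?_,
    fun x => mul_le_mul_of_nonneg_left (hmax x) hl0.le, ?_, fun x => ?_, fun hanti => ?_⟩
  · simp_rw [hmul]
    exact hΦp.const_mul _
  · simpa using hlim.const_mul l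
  · show κ * (l * Φ x) = ∫ y, K (x - y) * (l * Φ y) ^ p
    simp_rw [hmul, mul_left_comm (K _)]
    rw [integral_const_mul, ← heq, show l ^ p = l ^ (p - 1) * l by
      rw [← Real.rpow_add_one hl0.ne', sub_add_cancel], hlp]
    field_simp
  · obtain ⟨h1, h2⟩ := hbell hanti
    exact ⟨fun x => by simp only [h1 x],
      fun x hx y hy hxy => mul_le_mul_of_nonneg_left (h2 hx hy hxy) hl0.le⟩

lemma le_of_abs_le_abs {f : ℝ → ℝ} (heven : Function.Even f) (hanti : AntitoneOn f (Ici 0))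
    {x y : ℝ} (h : |x| ≤ |y|) : f y ≤ f x := by
  have habs : ∀ x, f |x| = f x := fun x => by
    rcases abs_choice x with h | h <;> rw [h]
    exact heven x
  rw [← habs x, ← habs y]
  exact hanti (abs_nonneg x) (abs_nonneg y) h

/-- Subtract from the equation at `x` the equation at `y`, and symmetrise by the reflection in the
midpoint: the integrand becomes nonnegative. If the two values agree, then it vanishes, so that
`Φ` takes equal values at all reflected points. This flatness spreads to infinity. -/
theorem strictAntiOn_of_solution (hK : BumpKernel K L) (hKanti : StrictAntiOn K (Icc 0 1))
    (hp : 1 < p) (hpos : ∀ x, 0 < Φ x) (hc : Continuous Φ)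
    (heq : ∀ x, κ * Φ x = ∫ y, K (x - y) * Φ y ^ p)
    (hlim : Filter.Tendsto Φ Filter.atTop (nhds 0)) (heven : Function.Even Φ)
    (hanti : AntitoneOn Φ (Ici 0)) : StrictAntiOn Φ (Ioi 0) := by
  have hp0 : 0 < p := by linarith
  have hcp : Continuous fun y => Φ y ^ p := hc.rpow_const fun y => Or.inr hp0.le
  have hKanti' : AntitoneOn K (Ici 0) := by
    intro x hx y hy hxy
    by_cases h1 : y ≤ 1
    · exact hKanti.antitoneOn ⟨hx, hxy.trans h1⟩ ⟨hy, h1⟩ hxy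
    · rw [hK.vanish y (by rw [abs_of_nonneg hy]; linarith)]
      exact hK.nonneg x
  -- equality of two values of `Φ` forces symmetry about their midpoint, where the kernel sees it
  have hrefl : ∀ x y : ℝ, x < y → Φ x = Φ y → 0 < x → ∀ s ∈ Ioc (x - 1) x,
      Φ s = Φ (x + y - s) := by
    intro x y hxy hΦxy hx s hs
    by_contra hne
    set g : ℝ → ℝ := fun s => (K (x - s) - K (y - s)) * (Φ s ^ p - Φ (x + y - s) ^ p) with hg
    have habs : ∀ s, s ≤ (x + y) / 2 → |x - s| ≤ |y - s| ∧ |s| ≤ |x + y - s| := by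
      intro s hs
      rw [← sq_le_sq, ← sq_le_sq]
      constructor
      · nlinarith [mul_nonneg (sub_nonneg.2 hxy.le) (sub_nonneg.2 hs)]
      · nlinarith [mul_nonneg (by linarith : 0 ≤ x + y) (sub_nonneg.2 hs)]
    have hle : ∀ s, s ≤ (x + y) / 2 → K (y - s) ≤ K (x - s) ∧ Φ (x + y - s) ^ p ≤ Φ s ^ p := by
      intro s hs
      obtain ⟨h1, h2⟩ := habs s hs
      exact ⟨le_of_abs_le_abs (f := K) hK.even hKanti' h1,
        Real.rpow_le_rpow (hpos _).le (le_of_abs_le_abs heven hanti h2) hp0.le⟩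
    have hg0 : ∀ s, 0 ≤ g s := by
      intro s
      rcases le_total s ((x + y) / 2) with h | h
      · obtain ⟨h1, h2⟩ := hle s h
        exact mul_nonneg (sub_nonneg.2 h1) (sub_nonneg.2 h2)
      · obtain ⟨h1, h2⟩ := hle (x + y - s) (by linarith)
        rw [show y - (x + y - s) = -(x - s) by ring, hK.even,
          show x - (x + y - s) = -(y - s) by ring, hK.even] at h1
        rw [sub_sub_cancel] at h2
        exact mul_nonneg_of_nonpos_of_nonpos (sub_nonpos.2 h1) (sub_nonpos.2 h2)
    have hcr : Continuous fun s => Φ (x + y - s) ^ p :=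
      hcp.comp (continuous_const.sub continuous_id)
    have i1 := hK.integrable_mul x hcp
    have i2 := hK.integrable_mul y hcp
    have i3 := hK.integrable_mul x hcr
    have i4 := hK.integrable_mul y hcr
    have hgeq : g = fun s => (K (x - s) * Φ s ^ p - K (y - s) * Φ s ^ p) -
        (K (x - s) * Φ (x + y - s) ^ p - K (y - s) * Φ (x + y - s) ^ p) := by
      ext s; simp only [hg]; ring
    have hgint : Integrable g := by
      rw [hgeq]; exact (i1.sub i2).sub (i3.sub i4)
    have hgcont : Continuous g :=
      ((hK.continuous.comp (continuous_const.sub continuous_id)).sub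
        (hK.continuous.comp (continuous_const.sub continuous_id))).mul (hcp.sub hcr)
    have e3 : ∫ s, K (x - s) * Φ (x + y - s) ^ p = κ * Φ y := by
      rw [heq, ← integral_sub_left_eq_self _ volume (x + y)]
      congr 1; ext s
      rw [sub_sub_cancel, ← hK.even]
      congr 2; ring
    have e4 : ∫ s, K (y - s) * Φ (x + y - s) ^ p = κ * Φ x := by
      rw [heq, ← integral_sub_left_eq_self _ volume (x + y)]
      congr 1; ext s
      rw [sub_sub_cancel, ← hK.even]
      congr 2; ring
    have hgz : ∫ s, g s = 0 := by
      have e5 : ∫ s, g s = (∫ s, K (x - s) * Φ s ^ p - K (y - s) * Φ s ^ p) -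
          ∫ s, K (x - s) * Φ (x + y - s) ^ p - K (y - s) * Φ (x + y - s) ^ p := by
        rw [hgeq]; exact integral_sub (i1.sub i2) (i3.sub i4)
      rw [e5, integral_sub i1 i2, integral_sub i3 i4, e3, e4, ← heq, ← heq, hΦxy]
      ring
    have hK1 : K (y - s) < K (x - s) := by
      have h1 : |x - s| = x - s := abs_of_nonneg (by linarith [hs.2])
      have h2 : |y - s| = y - s := abs_of_nonneg (by linarith [hs.2])
      have h3 : K (y - s) = K (min (y - s) 1) := by
        rcases le_total (y - s) 1 with h | h
        · rw [min_eq_left h]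
        · rw [min_eq_right h, hK.vanish _ (by rw [h2]; exact h), hK.vanish 1 (by simp)]
      rw [h3]
      refine hKanti ⟨by linarith [hs.2], by linarith [hs.1]⟩
        ⟨le_min (by linarith [hs.2]) zero_le_one, min_le_right _ _⟩ ?_
      exact lt_min (by linarith) (by linarith [hs.1])
    have hgs : g s ≠ 0 := by
      refine mul_ne_zero (sub_pos.2 hK1).ne' (sub_ne_zero.2 fun h => hne ?_)
      exact (Real.rpow_left_inj (hpos _).le (hpos _).le hp0.ne').1 h
    have := integral_pos_of_integrable_nonneg_nonzero hgcont hgint hg0 hgs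
    linarith
  intro x hx y hy hxy
  rw [Set.mem_Ioi] at hx hy
  refine lt_of_le_of_ne (hanti hx.le hy.le hxy.le) fun hΦxy => ?_
  set δ := min (1 / 2) x with hδ
  have hδ0 : 0 < δ := lt_min (by norm_num) hx
  have hδ1 : δ ≤ 1 / 2 := min_le_left _ _
  have hδx : δ ≤ x := min_le_right _ _
  have hflat : ∀ k : ℕ, Φ (y + k * δ) = Φ x := by
    intro k
    induction k with
    | zero => simpa using hΦxy
    | succ k ih =>
      have hk : (0 : ℝ) ≤ k * δ := by positivity
      have h1 := hrefl x (y + k * δ) (by linarith) ih.symm hx (x - δ)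
        ⟨by linarith, by linarith⟩
      rw [show x + (y + k * δ) - (x - δ) = y + (k + 1 : ℕ) * δ by push_cast; ring] at h1
      refine le_antisymm ?_ ?_
      · refine hanti hx.le (Set.mem_Ici.2 (by push_cast; linarith)) (by push_cast; linarith)
      · rw [← h1]
        exact hanti (Set.mem_Ici.2 (by linarith)) hx.le (by linarith)
  have htop : Filter.Tendsto (fun k : ℕ => y + k * δ) Filter.atTop Filter.atTop :=
    Filter.tendsto_atTop_add_const_left _ _
      (tendsto_natCast_atTop_atTop.atTop_mul_const hδ0)
  have h1 := hlim.comp htop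
  have h2 : (Φ ∘ fun k : ℕ => y + k * δ) = fun _ => Φ x := funext hflat
  rw [h2] at h1
  have := tendsto_nhds_unique tendsto_const_nhds h1
  exact (hpos x).ne' this

/-- For a decreasing profile the equation gives `Φ (x + 1) ≤ D Φ (x) ^ p`. Once `Φ` is small, this
raises it to the power `p` at each unit step. -/
theorem doublyExponentialDecay_of_solution (hK : BumpKernel K L) (hp : 1 < p) (hκ : 0 < κ)
    (hpos : ∀ x, 0 < Φ x) (heq : ∀ x, κ * Φ x = ∫ y, K (x - y) * Φ y ^ p)
    (hlim : Filter.Tendsto Φ Filter.atTop (nhds 0)) (heven : Function.Even Φ)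
    (hanti : AntitoneOn Φ (Ici 0)) : MiM.DoublyExponentialDecay p Φ := by
  have hL := hK.lip_pos
  have hp0 : 0 < p := by linarith
  set D := 2 * L / κ with hD
  have hD0 : 0 < D := by positivity
  have hstep : ∀ x, 0 ≤ x → Φ (x + 1) ≤ D * Φ x ^ p := by
    intro x hx
    have h1 := mul_le_rpow_of_le hK hp (fun x => (hpos x).le) heq (x := x + 1) (b := Φ x)
      fun y hy => hanti hx (Set.mem_Ici.2 (by linarith [hy.1])) (by linarith [hy.1])
    rw [hD, div_mul_eq_mul_div, le_div_iff₀ hκ]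
    linarith
  set E := D ^ (1 / (p - 1)) with hE
  have hE0 : 0 < E := by positivity
  have hEp : E * D = E ^ p := by
    have h1 : E ^ (p - 1) = D := by
      rw [hE, ← Real.rpow_mul hD0.le, one_div_mul_cancel (by linarith), Real.rpow_one]
    rw [← h1, mul_comm, ← Real.rpow_add_one hE0.ne', sub_add_cancel]
  have hlim' : Filter.Tendsto (fun k : ℕ => E * Φ k) Filter.atTop (nhds 0) := by
    have := (hlim.comp tendsto_natCast_atTop_atTop (α := ℕ)).const_mul E
    simpa using this
  obtain ⟨X, hX⟩ := (hlim'.eventually (gt_mem_nhds (Real.exp_pos (-1)))).exists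
  have hiter : ∀ k : ℕ, E * Φ (X + k) ≤ Real.exp (-p ^ (k : ℝ)) := by
    intro k
    induction k with
    | zero => simpa using hX.le
    | succ k ih =>
      have h1 := hstep (X + k) (by positivity)
      have h2 : X + ((k + 1 : ℕ) : ℝ) = X + k + 1 := by push_cast; ring
      rw [h2]
      calc E * Φ (X + k + 1) ≤ E * (D * Φ (X + k) ^ p) := by gcongr
        _ = (E * Φ (X + k)) ^ p := by
            rw [Real.mul_rpow hE0.le (hpos _).le, ← hEp, mul_assoc]
        _ ≤ (Real.exp (-p ^ (k : ℝ))) ^ p :=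
            Real.rpow_le_rpow (mul_nonneg hE0.le (hpos _).le) ih hp0.le
        _ = Real.exp (-p ^ ((k + 1 : ℕ) : ℝ)) := by
            rw [← Real.exp_mul]
            push_cast
            rw [Real.rpow_add_one hp0.ne', neg_mul]
  set a := p ^ (-((X : ℝ) + 1)) with ha
  have ha0 : 0 < a := by positivity
  have hap : ∀ x : ℝ, a * p ^ x = p ^ (x - X - 1) := by
    intro x
    rw [ha, ← Real.rpow_add hp0]
    congr 1; ring
  refine ⟨E⁻¹ + Φ 0 * Real.exp 1, add_pos (inv_pos.2 hE0) (mul_pos (hpos 0) (Real.exp_pos 1)), a, ha0,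
    fun x => ?_⟩
  rw [abs_of_pos (hpos x), add_mul, hap]
  have hx : Φ x = Φ |x| := by
    rcases abs_choice x with h | h <;> rw [h]
    exact (heven x).symm
  rcases le_total (X : ℝ) |x| with hXx | hXx
  · have h1 : (⌊|x| - X⌋₊ : ℝ) ≤ |x| - X := Nat.floor_le (by linarith)
    have h2 : |x| - X < ⌊|x| - X⌋₊ + 1 := Nat.lt_floor_add_one _
    set k := ⌊|x| - X⌋₊ with hk
    have h3 : Φ x ≤ Φ (X + k) := by
      rw [hx]
      exact hanti (Set.mem_Ici.2 (by positivity)) (Set.mem_Ici.2 (abs_nonneg x)) (by linarith)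
    have h4 : Φ x ≤ E⁻¹ * Real.exp (-p ^ (k : ℝ)) := by
      rw [inv_mul_eq_div, le_div_iff₀ hE0, mul_comm]
      exact (mul_le_mul_of_nonneg_left h3 hE0.le).trans (hiter k)
    have h5 : p ^ (|x| - X - 1) ≤ p ^ (k : ℝ) :=
      Real.rpow_le_rpow_of_exponent_le hp.le (by linarith)
    have h6 : E⁻¹ * Real.exp (-p ^ (k : ℝ)) ≤ E⁻¹ * Real.exp (-p ^ (|x| - X - 1)) := by gcongr
    have h7 : 0 ≤ Φ 0 * Real.exp 1 * Real.exp (-p ^ (|x| - X - 1)) := by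
      have := hpos 0
      positivity
    linarith
  · have h1 : p ^ (|x| - X - 1) ≤ 1 := Real.rpow_le_one_of_one_le_of_nonpos hp.le (by linarith)
    have h2 : Φ x ≤ Φ 0 := by
      rw [hx]
      exact hanti Set.self_mem_Ici (Set.mem_Ici.2 (abs_nonneg x)) (abs_nonneg x)
    have h3 : Φ 0 ≤ Φ 0 * Real.exp 1 * Real.exp (-p ^ (|x| - X - 1)) := by
      rw [mul_assoc, ← Real.exp_add]
      exact le_mul_of_one_le_right (hpos 0).le (Real.one_le_exp (by linarith))
    have h4 : 0 ≤ E⁻¹ * Real.exp (-p ^ (|x| - X - 1)) := by positivity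
    linarith

end Profile

/-! ### The anti-resonant kernel -/

/-- The kernel with frequency `μ` and tent coefficient `a`, written as a function of `(1 - |x|)₊`.
It agrees with `MiM.kernel` in the anti-resonant case, where `μ` is a multiple of `2π`. -/
noncomputable def resonantKernel (a μ x : ℝ) : ℝ :=
  a * max (1 - |x|) 0 + Real.sin (μ * max (1 - |x|) 0) / μ

section Kernel

variable {a μ : ℝ}

lemma sin_resonant_reflect (hsin : Real.sin μ = 0) (hcos : Real.cos μ = 1) (t : ℝ) :
    Real.sin (μ * (1 - t)) = -Real.sin (μ * t) := by
  rw [mul_sub, mul_one, Real.sin_sub, hsin, hcos]; ring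

lemma kernel_eq_resonantKernel {A c : ℝ} (hsin : Real.sin (A / c) = 0)
    (hcos : Real.cos (A / c) = 1) (x : ℝ) :
    MiM.kernel A c x = resonantKernel (A ^ 2 - 1) (A / c) x := by
  rw [MiM.kernel, MiM.tent, MiM.oscKernel, resonantKernel, hsin, hcos]
  congr 1
  split_ifs with h
  · rw [max_eq_left (by linarith), sin_resonant_reflect hsin hcos]
    rcases lt_trichotomy x 0 with hx | rfl | hx
    · rw [sign_neg hx, abs_of_neg hx, mul_neg, Real.sin_neg]
      simp
    · simp
    · rw [sign_pos hx, abs_of_pos hx]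
      simp
  · rw [max_eq_right (by linarith)]
    simp

lemma abs_positivePart_sub_le (x y : ℝ) : |max (1 - |x|) 0 - max (1 - |y|) 0| ≤ |x - y| := by
  refine (abs_max_sub_max_le_abs _ _ _).trans ?_
  rw [sub_sub_sub_cancel_left, abs_sub_comm]
  exact abs_abs_sub_abs_le x y

lemma bumpKernel_resonantKernel (ha : 0 < a) (hμ : 0 < μ) (hsin : Real.sin μ = 0)
    (hpos : ∀ z, 0 < z → 0 ≤ a + Real.sin z / z) : BumpKernel (resonantKernel a μ) (a + 1) where
  nonneg x := by
    rw [resonantKernel]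
    rcases (le_max_right (1 - |x|) 0).eq_or_lt with h | h
    · rw [← h]; simp
    · set y := max (1 - |x|) 0
      have h1 : a * y + Real.sin (μ * y) / μ = y * (a + Real.sin (μ * y) / (μ * y)) := by
        field_simp
      rw [h1]
      exact mul_nonneg h.le (hpos _ (by positivity))
  even x := by rw [resonantKernel, resonantKernel, abs_neg]
  vanish x hx := by
    rw [resonantKernel, max_eq_right (by linarith)]
    simp
  lip x y := by
    rw [resonantKernel, resonantKernel]
    have h1 := abs_positivePart_sub_le x y
    set u := max (1 - |x|) 0
    set v := max (1 - |y|) 0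
    calc |a * u + Real.sin (μ * u) / μ - (a * v + Real.sin (μ * v) / μ)|
        = |a * (u - v) + (Real.sin (μ * u) - Real.sin (μ * v)) / μ| := by congr 1; ring
      _ ≤ |a * (u - v)| + |(Real.sin (μ * u) - Real.sin (μ * v)) / μ| := abs_add_le _ _
      _ = a * |u - v| + |Real.sin (μ * u) - Real.sin (μ * v)| / μ := by
          rw [abs_mul, abs_div, abs_of_pos ha, abs_of_pos hμ]
      _ ≤ a * |u - v| + |μ * u - μ * v| / μ := by
          gcongr _ + ?_ / _
          exact Real.abs_sin_sub_sin_le _ _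
      _ = (a + 1) * |u - v| := by
          rw [← mul_sub, abs_mul, abs_of_pos hμ]; field_simp
      _ ≤ (a + 1) * |x - y| := by gcongr
  pos := by
    rw [resonantKernel]
    simp [hsin, ha]

lemma neg_lt_sin {t : ℝ} (ht : 0 < t) : -t < Real.sin t := by
  have := Real.lt_sin (neg_neg_of_pos ht)
  rcases le_or_gt t Real.pi with h | h
  · linarith [Real.sin_nonneg_of_nonneg_of_le_pi ht.le h]
  · linarith [Real.neg_one_le_sin t, Real.pi_gt_three]

lemma strictMono_add_sin (ha : 1 ≤ a) (hμ : 0 < μ) :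
    StrictMono fun y => a * y + Real.sin (μ * y) / μ := by
  intro u v huv
  set t := μ * (v - u) / 2 with ht
  have ht0 : 0 < t := by have := sub_pos.2 huv; positivity
  have h1 : Real.sin (μ * u) - Real.sin (μ * v) < 2 * t := by
    rw [Real.sin_sub_sin, show (μ * u - μ * v) / 2 = -t by rw [ht]; ring, Real.sin_neg]
    have h2 : |Real.sin t| < t := abs_lt.2 ⟨neg_lt_sin ht0, Real.sin_lt ht0⟩
    have h3 := Real.abs_cos_le_one ((μ * u + μ * v) / 2)
    have h4 : |Real.sin t * Real.cos ((μ * u + μ * v) / 2)| ≤ |Real.sin t| := by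
      rw [abs_mul]; exact mul_le_of_le_one_right (abs_nonneg _) h3
    have h5 := neg_abs_le (Real.sin t * Real.cos ((μ * u + μ * v) / 2))
    linarith
  have h2 : (Real.sin (μ * u) - Real.sin (μ * v)) / μ < v - u := by
    rw [div_lt_iff₀ hμ]
    calc _ < 2 * t := h1
      _ = (v - u) * μ := by rw [ht]; ring
  rw [sub_div] at h2
  have h3 : v - u ≤ a * (v - u) := le_mul_of_one_le_left (by linarith) ha
  show a * u + Real.sin (μ * u) / μ < a * v + Real.sin (μ * v) / μ
  linarith

lemma strictAntiOn_resonantKernel (ha : 1 ≤ a) (hμ : 0 < μ) :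
    StrictAntiOn (resonantKernel a μ) (Icc 0 1) := by
  intro x hx y hy hxy
  rw [resonantKernel, resonantKernel, abs_of_nonneg hx.1, abs_of_nonneg hy.1,
    max_eq_left (sub_nonneg.2 hx.2), max_eq_left (sub_nonneg.2 hy.2)]
  exact strictMono_add_sin ha hμ (by linarith)

lemma resonantKernel_of_abs_le (hsin : Real.sin μ = 0) (hcos : Real.cos μ = 1) {x : ℝ}
    (hx : |x| ≤ 1) :
    resonantKernel a μ x = a * (1 - |x|) - Real.sin (μ * |x|) / μ := by
  rw [resonantKernel, max_eq_left (by linarith), sin_resonant_reflect hsin hcos]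
  ring

end Kernel

/-! ### Smoothness -/

lemma contDiff_primitive {f : ℝ → ℝ} {k : ℕ} (hf : ContDiff ℝ k f) :
    ContDiff ℝ (k + 1 : ℕ) fun x => ∫ y in (0 : ℝ)..x, f y := by
  have h1 : ∀ x, HasDerivAt (fun x => ∫ y in (0 : ℝ)..x, f y) (f x) x := fun x =>
    intervalIntegral.integral_hasDerivAt_right (hf.continuous.intervalIntegrable _ _)
      hf.continuous.stronglyMeasurable.stronglyMeasurableAtFilter hf.continuous.continuousAt
  have h2 : deriv (fun x => ∫ y in (0 : ℝ)..x, f y) = f := funext fun x => (h1 x).deriv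
  rw [Nat.cast_add, Nat.cast_one, contDiff_succ_iff_deriv]
  refine ⟨fun x => (h1 x).differentiableAt, by simp, ?_⟩
  rwa [h2]

/-- Convolution with the kernel gains one derivative. On each side of the diagonal the addition
theorem separates the variables, which reduces the claim to primitives. -/
lemma contDiff_resonantKernel_integral {a μ : ℝ} (hsin : Real.sin μ = 0) (hcos : Real.cos μ = 1)
    {L : ℝ} (hK : BumpKernel (resonantKernel a μ) L) {Z : ℝ → ℝ} {k : ℕ} (hZ : ContDiff ℝ k Z) :
    ContDiff ℝ (k + 1 : ℕ) fun x => ∫ y, resonantKernel a μ (x - y) * Z y := by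
  have hc := hZ.continuous
  set F : (ℝ → ℝ) → ℝ → ℝ := fun g x => ∫ y in (0 : ℝ)..x, g y * Z y with hF
  have hsub : ∀ g : ℝ → ℝ, Continuous g → ∀ u v, ∫ y in u..v, g y * Z y = F g v - F g u := by
    intro g hg u v
    exact (intervalIntegral.integral_interval_sub_left ((hg.mul hc).intervalIntegrable _ _)
      ((hg.mul hc).intervalIntegrable _ _)).symm
  have hFC : ∀ g : ℝ → ℝ, ContDiff ℝ k g → ContDiff ℝ (k + 1 : ℕ) (F g) := fun g hg =>
    contDiff_primitive (hg.mul hZ)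
  set f₁ : ℝ → ℝ := fun _ => 1 with hf₁
  set f₂ : ℝ → ℝ := fun y => y with hf₂
  set f₃ : ℝ → ℝ := fun y => Real.sin (μ * y) with hf₃
  set f₄ : ℝ → ℝ := fun y => Real.cos (μ * y) with hf₄
  have c₁ : Continuous f₁ := by fun_prop
  have c₂ : Continuous f₂ := by fun_prop
  have c₃ : Continuous f₃ := by fun_prop
  have c₄ : Continuous f₄ := by fun_prop
  have d₁ := hFC f₁ (by fun_prop)
  have d₂ := hFC f₂ (by fun_prop)
  have d₃ := hFC f₃ (by fun_prop)
  have d₄ := hFC f₄ (by fun_prop)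
  have hform : (fun x => ∫ y, resonantKernel a μ (x - y) * Z y) = fun x =>
      (a * (1 - x) * (F f₁ x - F f₁ (x - 1)) + a * (F f₂ x - F f₂ (x - 1)) -
        1 / μ * Real.sin (μ * x) * (F f₄ x - F f₄ (x - 1)) +
        1 / μ * Real.cos (μ * x) * (F f₃ x - F f₃ (x - 1))) +
      (a * (1 + x) * (F f₁ (x + 1) - F f₁ x) - a * (F f₂ (x + 1) - F f₂ x) -
        1 / μ * Real.cos (μ * x) * (F f₃ (x + 1) - F f₃ x) +
        1 / μ * Real.sin (μ * x) * (F f₄ (x + 1) - F f₄ x)) := by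
    ext x
    have hKc : Continuous fun y => resonantKernel a μ (x - y) * Z y :=
      (hK.continuous.comp (continuous_const.sub continuous_id)).mul hc
    have h0 : ∫ y, resonantKernel a μ (x - y) * Z y =
        ∫ y in (x - 1)..(x + 1), resonantKernel a μ (x - y) * Z y := by
      rw [intervalIntegral.integral_of_le (by linarith), ← integral_Icc_eq_integral_Ioc]
      refine (setIntegral_eq_integral_of_forall_compl_eq_zero fun y hy => ?_).symm
      rw [hK.eq_zero_of_notMem hy, zero_mul]
    rw [h0, ← intervalIntegral.integral_add_adjacent_intervals (b := x)
      (hKc.intervalIntegrable _ _) (hKc.intervalIntegrable _ _)]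
    have i : ∀ (g : ℝ → ℝ), Continuous g → ∀ r u v : ℝ,
        IntervalIntegrable (fun y => r * (g y * Z y)) volume u v := fun g hg r u v =>
      ((continuous_const.mul (hg.mul hc)).intervalIntegrable _ _)
    congr 1
    · rw [← hsub _ c₁, ← hsub _ c₂, ← hsub _ c₃, ← hsub _ c₄,
        ← intervalIntegral.integral_const_mul, ← intervalIntegral.integral_const_mul,
        ← intervalIntegral.integral_const_mul, ← intervalIntegral.integral_const_mul,
        ← intervalIntegral.integral_add (i _ c₁ _ _ _) (i _ c₂ _ _ _),
        ← intervalIntegral.integral_sub ((i _ c₁ _ _ _).add (i _ c₂ _ _ _)) (i _ c₄ _ _ _),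
        ← intervalIntegral.integral_add
          (((i _ c₁ _ _ _).add (i _ c₂ _ _ _)).sub (i _ c₄ _ _ _)) (i _ c₃ _ _ _)]
      refine intervalIntegral.integral_congr fun y hy => ?_
      rw [Set.uIcc_of_le (by linarith)] at hy
      have h1 : |x - y| = x - y := abs_of_nonneg (by linarith [hy.2])
      simp only [hf₁, hf₂, hf₃, hf₄]
      rw [resonantKernel_of_abs_le hsin hcos (by rw [h1]; linarith [hy.1]), h1, mul_sub μ,
        Real.sin_sub]
      ring
    · rw [← hsub _ c₁, ← hsub _ c₂, ← hsub _ c₃, ← hsub _ c₄,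
        ← intervalIntegral.integral_const_mul, ← intervalIntegral.integral_const_mul,
        ← intervalIntegral.integral_const_mul, ← intervalIntegral.integral_const_mul,
        ← intervalIntegral.integral_sub (i _ c₁ _ _ _) (i _ c₂ _ _ _),
        ← intervalIntegral.integral_sub ((i _ c₁ _ _ _).sub (i _ c₂ _ _ _)) (i _ c₃ _ _ _),
        ← intervalIntegral.integral_add
          (((i _ c₁ _ _ _).sub (i _ c₂ _ _ _)).sub (i _ c₃ _ _ _)) (i _ c₄ _ _ _)]
      refine intervalIntegral.integral_congr fun y hy => ?_
      rw [Set.uIcc_of_le (by linarith)] at hy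
      have h1 : |x - y| = y - x := by
        rw [abs_sub_comm]; exact abs_of_nonneg (by linarith [hy.1])
      simp only [hf₁, hf₂, hf₃, hf₄]
      rw [resonantKernel_of_abs_le hsin hcos (by rw [h1]; linarith [hy.2]), h1, mul_sub μ,
        Real.sin_sub]
      ring
  rw [hform]
  have hp : ContDiff ℝ (k + 1 : ℕ) fun x : ℝ => x + 1 := by fun_prop
  have hm : ContDiff ℝ (k + 1 : ℕ) fun x : ℝ => x - 1 := by fun_prop
  have p₁ := d₁.comp hp
  have p₂ := d₂.comp hp
  have p₃ := d₃.comp hp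
  have p₄ := d₄.comp hp
  have m₁ := d₁.comp hm
  have m₂ := d₂.comp hm
  have m₃ := d₃.comp hm
  have m₄ := d₄.comp hm
  simp only [Function.comp_def] at p₁ p₂ p₃ p₄ m₁ m₂ m₃ m₄
  clear_value F
  fun_prop

theorem contDiff_of_solution {a μ κ p L : ℝ} (hsin : Real.sin μ = 0) (hcos : Real.cos μ = 1)
    (hK : BumpKernel (resonantKernel a μ) L) (hκ : 0 < κ) {Φ : ℝ → ℝ} (hpos : ∀ x, 0 < Φ x)
    (hc : Continuous Φ) (heq : ∀ x, κ * Φ x = ∫ y, resonantKernel a μ (x - y) * Φ y ^ p) :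
    ContDiff ℝ ∞ Φ := by
  rw [contDiff_infty]
  intro k
  induction k with
  | zero => exact contDiff_zero.2 hc
  | succ k ih =>
    have h1 : ContDiff ℝ k fun x => Φ x ^ p := ih.rpow_const_of_ne fun x => (hpos x).ne'
    have h2 := (contDiff_resonantKernel_integral hsin hcos hK h1).const_smul κ⁻¹
    convert h2 using 1
    ext x
    rw [← heq, smul_eq_mul, inv_mul_cancel_left₀ hκ.ne']

/-! ### The Fourier symbol -/

lemma integral_resonantKernel_mul_cos {a μ w : ℝ} (hμ : μ ≠ 0) (hsin : Real.sin μ = 0)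
    (hcos : Real.cos μ = 1) (hw : w ≠ 0) (hμw : μ ^ 2 - w ^ 2 ≠ 0) :
    ∫ x in (0 : ℝ)..1, 2 * (resonantKernel a μ x * Real.cos (w * x)) =
      2 * a * (1 - Real.cos w) / w ^ 2 - 2 * (1 - Real.cos w) / (μ ^ 2 - w ^ 2) := by
  set P : ℝ → ℝ := fun x =>
    2 * a * ((1 - x) * Real.sin (w * x) / w - Real.cos (w * x) / w ^ 2) -
    2 / μ * ((-(μ * (Real.cos (μ * x) * Real.cos (w * x))) -
      w * (Real.sin (μ * x) * Real.sin (w * x))) / (μ ^ 2 - w ^ 2)) with hP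
  have hderiv : ∀ x, HasDerivAt P (2 * ((a * (1 - x) - Real.sin (μ * x) / μ) * Real.cos (w * x))) x := by
    intro x
    have hl : ∀ r : ℝ, HasDerivAt (fun x : ℝ => r * x) r x := fun r => by
      simpa using (hasDerivAt_id x).const_mul r
    have s₁ := (hl w).sin
    have c₁ := (hl w).cos
    have s₂ := (hl μ).sin
    have c₂ := (hl μ).cos
    have h1 := ((((hasDerivAt_id x).const_sub 1).mul s₁).div_const w).sub (c₁.div_const (w ^ 2))
    have h2 := ((((c₂.mul c₁).const_mul μ).neg).sub ((s₂.mul s₁).const_mul w)).div_const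
      (μ ^ 2 - w ^ 2)
    refine ((h1.const_mul (2 * a)).sub (h2.const_mul (2 / μ))).congr_deriv ?_
    simp only [id]
    field_simp
    ring
  have hcongr : ∫ x in (0 : ℝ)..1, 2 * (resonantKernel a μ x * Real.cos (w * x)) =
      ∫ x in (0 : ℝ)..1, 2 * ((a * (1 - x) - Real.sin (μ * x) / μ) * Real.cos (w * x)) := by
    refine intervalIntegral.integral_congr fun x hx => ?_
    rw [Set.uIcc_of_le zero_le_one] at hx
    have h1 : |x| = x := abs_of_nonneg hx.1
    rw [resonantKernel_of_abs_le hsin hcos (by rw [h1]; exact hx.2), h1]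
  rw [hcongr, intervalIntegral.integral_eq_sub_of_hasDerivAt (fun x _ => hderiv x)
    (Continuous.intervalIntegrable (by fun_prop) _ _)]
  simp only [hP]
  simp only [mul_zero, mul_one, Real.sin_zero, Real.cos_zero, hsin, hcos]
  field_simp
  ring

lemma fourier_resonantKernel {a μ L : ℝ} (hK : BumpKernel (resonantKernel a μ) L) (hμ : μ ≠ 0)
    (hsin : Real.sin μ = 0) (hcos : Real.cos μ = 1) {ξ : ℝ} (hξ : ξ ≠ 0)
    (hμξ : μ ^ 2 - (2 * Real.pi * ξ) ^ 2 ≠ 0) :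
    𝓕 (fun x : ℝ => (resonantKernel a μ x : ℂ)) ξ =
      ((Real.sin (Real.pi * ξ) ^ 2 * (a / (Real.pi ^ 2 * ξ ^ 2) -
        4 / (μ ^ 2 - (2 * Real.pi * ξ) ^ 2)) : ℝ) : ℂ) := by
  set w := 2 * Real.pi * ξ with hw
  have hw0 : w ≠ 0 := by
    have := Real.pi_ne_zero
    simp only [hw]; positivity
  set f : ℝ → ℂ := fun x => Complex.exp (((-2 * Real.pi * x * ξ : ℝ) : ℂ) * Complex.I) •
    (resonantKernel a μ x : ℂ) with hf
  have hfc : Continuous f := by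
    have := hK.continuous
    simp only [hf]
    fun_prop
  have h0 : ∫ x, f x = ∫ x in (-1 : ℝ)..1, f x := by
    rw [intervalIntegral.integral_of_le (by norm_num), ← integral_Icc_eq_integral_Ioc]
    refine (setIntegral_eq_integral_of_forall_compl_eq_zero fun x hx => ?_).symm
    have h1 : resonantKernel a μ x = 0 := by
      refine hK.vanish x ?_
      by_contra! h
      exact hx ⟨(abs_lt.1 h).1.le, (abs_lt.1 h).2.le⟩
    simp [hf, h1]
  have h2 : ∫ x in (-1 : ℝ)..0, f x = ∫ x in (0 : ℝ)..1, f (-x) := by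
    rw [intervalIntegral.integral_comp_neg, neg_zero]
  rw [Real.fourier_real_eq_integral_exp_smul]
  show ∫ x, f x = _
  have hfn : Continuous fun x => f (-x) := hfc.comp continuous_neg
  rw [h0, ← intervalIntegral.integral_add_adjacent_intervals (b := 0)
    (hfc.intervalIntegrable _ _) (hfc.intervalIntegrable _ _), h2,
    ← intervalIntegral.integral_add (hfn.intervalIntegrable _ _)
      (hfc.intervalIntegrable _ _)]
  have h3 : ∀ x, f (-x) + f x =
      ((2 * (resonantKernel a μ x * Real.cos (w * x)) : ℝ) : ℂ) := by
    intro x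
    simp only [hf, hK.even x, smul_eq_mul]
    push_cast
    rw [Complex.cos]
    have e1 : (-2 * (Real.pi : ℂ) * -(x : ℂ) * ξ) * Complex.I = (w : ℂ) * x * Complex.I := by
      rw [hw]; push_cast; ring
    have e2 : (-2 * (Real.pi : ℂ) * (x : ℂ) * ξ) * Complex.I = -((w : ℂ) * x) * Complex.I := by
      rw [hw]; push_cast; ring
    rw [e1, e2]
    ring
  simp_rw [h3]
  rw [intervalIntegral.integral_ofReal, integral_resonantKernel_mul_cos hμ hsin hcos hw0 hμξ]
  congr 1
  have h4 : 1 - Real.cos w = 2 * Real.sin (Real.pi * ξ) ^ 2 := by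
    rw [hw, mul_assoc, Real.cos_two_mul, Real.sin_sq]; ring
  rw [h4]
  have h5 : w ^ 2 = 4 * (Real.pi ^ 2 * ξ ^ 2) := by rw [hw]; ring
  have h6 : Real.pi ^ 2 * ξ ^ 2 ≠ 0 := by
    have := Real.pi_ne_zero
    positivity
  rw [show 2 * a * (2 * Real.sin (Real.pi * ξ) ^ 2) / w ^ 2 =
    Real.sin (Real.pi * ξ) ^ 2 * (a / (Real.pi ^ 2 * ξ ^ 2)) by rw [h5]; field_simp; ring]
  ring

/-- On the Fourier side the equation `κ Φ = K * Z` becomes multiplication by the symbol of `K`. -/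
lemma fourier_of_convolution {K Φ Z : ℝ → ℝ} {κ : ℝ} (hK : Integrable K) (hZ : Integrable Z)
    (heq : ∀ x, κ * Φ x = ∫ y, K (x - y) * Z y) (ξ : ℝ) :
    (κ : ℂ) * 𝓕 (fun x : ℝ => (Φ x : ℂ)) ξ =
      𝓕 (fun x : ℝ => (K x : ℂ)) ξ * 𝓕 (fun x : ℝ => (Z x : ℂ)) ξ := by
  have h0 := Real.fourier_mul_convolution_eq (f₁ := fun x : ℝ => (K x : ℂ))
    (f₂ := fun x : ℝ => (Z x : ℂ)) hK.ofReal hZ.ofReal ξ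
  rw [← h0]
  have h1 : convolution (fun x : ℝ => (K x : ℂ)) (fun x : ℝ => (Z x : ℂ))
      (ContinuousLinearMap.mul ℂ ℂ) volume = fun x => (κ : ℂ) * (Φ x : ℂ) := by
    ext x
    rw [convolution_eq_swap]
    simp only [ContinuousLinearMap.mul_apply']
    rw [← Complex.ofReal_mul, heq]
    simp_rw [← Complex.ofReal_mul]
    exact integral_ofReal
  rw [h1, Real.fourier_real_eq_integral_exp_smul, Real.fourier_real_eq_integral_exp_smul,
    ← integral_const_mul]
  congr 1
  ext x
  simp only [smul_eq_mul]
  ring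

/-! ### The threshold -/

lemma bddBelow_sin_div : BddBelow ((fun z : ℝ => Real.sin z / z) '' Ioi 0) := by
  refine ⟨-1, ?_⟩
  rintro _ ⟨z, hz, rfl⟩
  rw [Set.mem_Ioi] at hz
  simp only
  rw [le_div_iff₀ hz]
  linarith [neg_lt_sin hz]

/-- A point close to the minimiser of `sin z / z`. -/
lemma sInf_sin_div_le : sInf ((fun z : ℝ => Real.sin z / z) '' Ioi 0) ≤ 1 - 1.10328 ^ 2 := by
  have hpi1 := Real.pi_gt_d6
  have hpi2 := Real.pi_lt_d6
  -- the minimiser is `3π/2 - u` with `u` close to `0.219`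
  set z := Real.pi + Real.pi / 2 - 0.219 with hz
  have hz0 : 0 < z := by rw [hz]; linarith
  refine (csInf_le bddBelow_sin_div ⟨z, hz0, rfl⟩).trans ?_
  simp only
  rw [div_le_iff₀ hz0]
  have h1 : Real.sin z = -Real.cos 0.219 := by
    rw [hz, add_sub_assoc, add_comm, Real.sin_add_pi, Real.sin_pi_div_two_sub]
  have h2 : Real.cos 0.219 = 1 - 2 * Real.sin 0.1095 ^ 2 := by
    rw [show (0.219 : ℝ) = 2 * 0.1095 by norm_num, Real.cos_two_mul, Real.cos_sq']; ring
  have h3 := Real.sin_bound (x := 0.1095) (by rw [abs_of_pos (by norm_num)]; norm_num)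
  rw [abs_of_pos (by norm_num : (0 : ℝ) < 0.1095), abs_le] at h3
  have h4 : Real.sin 0.1095 ≤ 0.1092815 := by
    have := h3.2
    norm_num at this ⊢
    linarith
  have h5 : 0 ≤ Real.sin 0.1095 :=
    Real.sin_nonneg_of_nonneg_of_le_pi (by norm_num) (by linarith)
  have h6 : Real.sin 0.1095 ^ 2 ≤ 0.1092815 ^ 2 := by gcongr
  rw [h1, h2]
  have h7 : z ≤ 4.493390 := by rw [hz]; linarith
  norm_num at h6 ⊢
  linarith

lemma neg_le_sin_div {z : ℝ} (hz : 0 < z) : -0.217247 ≤ Real.sin z / z := by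
  have hpi1 := Real.pi_gt_d6
  have hpi2 := Real.pi_lt_d6
  rw [le_div_iff₀ hz]
  rcases le_or_gt z Real.pi with h | h
  · linarith [Real.sin_nonneg_of_nonneg_of_le_pi hz.le h]
  rcases le_or_gt (Real.pi + Real.pi / 2) z with h' | h'
  · linarith [Real.neg_one_le_sin z]
  set u := Real.pi + Real.pi / 2 - z with hu
  have h1 : Real.sin z = -Real.cos u := by
    rw [hu, show Real.pi + Real.pi / 2 - z = Real.pi / 2 - (z - Real.pi) by ring,
      Real.cos_pi_div_two_sub, Real.sin_sub_pi, neg_neg]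
  have hzu : z = Real.pi + Real.pi / 2 - u := by rw [hu]; ring
  have hu0 : 0 < u := by linarith
  rw [h1]
  rcases le_or_gt u 1 with h1 | h1
  · have h3 := Real.cos_bound (x := u) (by rw [abs_of_pos hu0]; exact h1)
    rw [abs_of_pos hu0, abs_le] at h3
    have h4 := h3.2
    -- `h5` is the remainder of the quartic upper bound of `cos` after its tangent at `0.2195`,
    -- a point close to where the margin is least
    have h5 : 0 ≤ (u - 0.2195) ^ 2 * (1 / 2 - 5 / 96 * (u ^ 2 + 2 * u * 0.2195 + 3 * 0.2195 ^ 2)) := by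
      refine mul_nonneg (sq_nonneg _) ?_
      nlinarith
    nlinarith
  · have h3 : Real.cos u ≤ Real.cos 1 :=
      Real.cos_le_cos_of_nonneg_of_le_pi zero_le_one (by linarith) h1.le
    have h4 := Real.cos_one_le
    norm_num at h4 ⊢
    linarith

lemma thresholdA_bounds : 1.10328 ≤ MiM.thresholdA ∧ MiM.thresholdA < 1.10329 := by
  have h1 := sInf_sin_div_le
  have h2 : -0.217247 ≤ sInf ((fun z : ℝ => Real.sin z / z) '' Ioi 0) := by
    refine le_csInf ⟨_, 1, Set.mem_Ioi.2 one_pos, rfl⟩ ?_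
    rintro _ ⟨z, hz, rfl⟩
    exact neg_le_sin_div hz
  rw [MiM.thresholdA]
  constructor
  · exact Real.le_sqrt_of_sq_le (by linarith)
  · rw [Real.sqrt_lt' (by norm_num)]
    norm_num at h2 ⊢
    linarith

lemma add_sin_div_nonneg_of_threshold_le {A : ℝ} (hA : MiM.thresholdA ≤ A) {z : ℝ} (hz : 0 < z) :
    0 ≤ A ^ 2 - 1 + Real.sin z / z := by
  have h1 := (Real.sqrt_le_iff.1 hA).2
  have h2 := csInf_le bddBelow_sin_div ⟨z, hz, rfl⟩
  simp only at h2
  linarith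

/-! ### Travelling waves -/

/-- The Fourier symbol of the kernel, divided by `A² c²`, is the symbol of the travelling-wave
equation. -/
lemma symbol_identity {A c ν ξ r : ℝ} (hc : c ≠ 0) (hν : 0 < ν) (hA2 : A ^ 2 = 1 + 1 / ν)
    (hξ : ξ ≠ 0) (hden : 1 + ν - 4 * Real.pi ^ 2 * c ^ 2 * ν * ξ ^ 2 ≠ 0) :
    (A / c) ^ 2 - (2 * Real.pi * ξ) ^ 2 ≠ 0 ∧
    r ^ 2 * ((A ^ 2 - 1) / (Real.pi ^ 2 * ξ ^ 2) - 4 / ((A / c) ^ 2 - (2 * Real.pi * ξ) ^ 2)) =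
      A ^ 2 * c ^ 2 * ((1 - 4 * Real.pi ^ 2 * c ^ 2 * ν * ξ ^ 2) /
        (1 + ν - 4 * Real.pi ^ 2 * c ^ 2 * ν * ξ ^ 2) * (r ^ 2 / (c ^ 2 * Real.pi ^ 2 * ξ ^ 2))) := by
  have hpi := Real.pi_ne_zero
  have h1 : (A / c) ^ 2 - (2 * Real.pi * ξ) ^ 2 =
      (1 + ν - 4 * Real.pi ^ 2 * c ^ 2 * ν * ξ ^ 2) / (ν * c ^ 2) := by
    rw [div_pow, hA2]
    field_simp
    ring
  rw [h1]
  refine ⟨div_ne_zero hden (by positivity), ?_⟩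
  rw [hA2]
  set D := 1 + ν - 4 * Real.pi ^ 2 * c ^ 2 * ν * ξ ^ 2 with hD
  have h2 : 1 - 4 * Real.pi ^ 2 * c ^ 2 * ν * ξ ^ 2 = D - ν := by rw [hD]; ring
  have h3 : 4 * Real.pi ^ 2 * c ^ 2 * ν * ξ ^ 2 = 1 + ν - D := by rw [hD]; ring
  rw [h2]
  field_simp
  linear_combination (-1) * h3

/-- All the conclusions, under the hypothesis that the kernel is nonnegative. -/
theorem exists_travellingWave {p ν c A : ℝ} (hp : 1 < p) (hν : 0 < ν) (hc : 0 < c)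
    (hA : 0 < A) (hA2 : A ^ 2 = 1 + 1 / ν) (hsin : Real.sin (A / c) = 0)
    (hcos : Real.cos (A / c) = 1) (hpos : ∀ z, 0 < z → 0 ≤ A ^ 2 - 1 + Real.sin z / z) :
    ∃ Φ : ℝ → ℝ, (∀ x, 0 < Φ x) ∧ MiM.SolvesConvolutionEq p A c (fun x => Φ x ^ p) ∧
      MiM.SolvesFourierEq p ν c Φ ∧
      (2 ≤ A ^ 2 → MiM.BellShaped Φ ∧ MiM.DoublyExponentialDecay p Φ) := by
  have hμ : 0 < A / c := div_pos hA hc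
  have ha : 0 < A ^ 2 - 1 := by
    rw [hA2, add_sub_cancel_left]; exact one_div_pos.2 hν
  have hK := bumpKernel_resonantKernel ha hμ hsin hpos
  have hkernel : MiM.kernel A c = resonantKernel (A ^ 2 - 1) (A / c) :=
    funext (kernel_eq_resonantKernel hsin hcos)
  have hκ : 0 < A ^ 2 * c ^ 2 := by positivity
  obtain ⟨Φ, hΦ, hΦc, hΦi, hΦpi, -, hlim, heq, hbell⟩ := exists_pos_solution hK hp hκ
  have hKint : Integrable (resonantKernel (A ^ 2 - 1) (A / c)) :=
    hK.continuous.integrable_of_hasCompactSupport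
      (HasCompactSupport.intro (isCompact_Icc (a := (-1 : ℝ)) (b := 1)) fun x hx => by
        refine hK.vanish x ?_
        by_contra! h
        exact hx ⟨(abs_lt.1 h).1.le, (abs_lt.1 h).2.le⟩)
  refine ⟨Φ, hΦ, ⟨hΦpi, fun x => ?_⟩, ⟨hΦi, hΦpi, fun ξ hξ hden => ?_⟩, fun h2 => ?_⟩
  · rw [← Real.rpow_mul (hΦ x).le, mul_one_div_cancel (by linarith), Real.rpow_one, heq,
      convolution_eq_swap, hkernel]
    rfl
  · obtain ⟨h1, h2⟩ := symbol_identity (r := Real.sin (Real.pi * ξ)) hc.ne' hν hA2 hξ hden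
    have h3 := fourier_of_convolution hKint hΦpi heq ξ
    rw [fourier_resonantKernel hK hμ.ne' hsin hcos hξ h1, h2,
      Complex.ofReal_mul (A ^ 2 * c ^ 2), mul_assoc ((A ^ 2 * c ^ 2 : ℝ) : ℂ)] at h3
    exact mul_left_cancel₀ (Complex.ofReal_ne_zero.2 hκ.ne') h3
  · have hstrict := strictAntiOn_resonantKernel (a := A ^ 2 - 1) (by linarith) hμ
    have hKanti : AntitoneOn (resonantKernel (A ^ 2 - 1) (A / c)) (Ici 0) := by
      intro x hx y hy hxy
      by_cases h1 : y ≤ 1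
      · exact hstrict.antitoneOn ⟨hx, hxy.trans h1⟩ ⟨hy, h1⟩ hxy
      · rw [hK.vanish y (by rw [abs_of_nonneg hy]; linarith)]
        exact hK.nonneg x
    obtain ⟨heven, hanti⟩ := hbell hKanti
    exact ⟨⟨hΦ, heven, contDiff_of_solution hsin hcos hK hκ hΦ hΦc heq,
      strictAntiOn_of_solution hK hstrict hp hΦ hΦc heq hlim heven hanti⟩,
      doublyExponentialDecay_of_solution hK hp hκ hΦ heq hlim heven hanti⟩

theorem theorem1 (p ν c A : ℝ) (hp : 1 < p) (hν : 0 < ν) (hA : A = √(1 + 1 / ν))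
    (n : ℕ) (hn : 1 ≤ n) (hμ : A / c = 2 * Real.pi * n) :
    (√2 ≤ A →
      ∃ Φ : ℝ → ℝ, MiM.BellShaped Φ ∧ MiM.DoublyExponentialDecay p Φ ∧
        MiM.SolvesConvolutionEq p A c (fun x => Φ x ^ p) ∧ MiM.SolvesFourierEq p ν c Φ) ∧
    (1.10328 ≤ MiM.thresholdA ∧ MiM.thresholdA < 1.10329) ∧
    (MiM.thresholdA ≤ A → A < √2 →
      ∃ Φ : ℝ → ℝ, (∀ x, 0 < Φ x) ∧
        MiM.SolvesConvolutionEq p A c (fun x => Φ x ^ p) ∧ MiM.SolvesFourierEq p ν c Φ) := by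
  have hν1 : 0 < 1 + 1 / ν := by positivity
  have hA0 : 0 < A := by rw [hA]; exact Real.sqrt_pos.2 hν1
  have hA2 : A ^ 2 = 1 + 1 / ν := by rw [hA, Real.sq_sqrt hν1.le]
  have hn0 : (0 : ℝ) < n := by exact_mod_cast hn
  have hμ0 : 0 < A / c := by rw [hμ]; have := Real.pi_pos; positivity
  have hc : 0 < c := (div_pos_iff_of_pos_left hA0).1 hμ0
  have hsin : Real.sin (A / c) = 0 := by
    rw [hμ, show 2 * Real.pi * n = ((2 * n : ℕ) : ℝ) * Real.pi by push_cast; ring]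
    exact Real.sin_nat_mul_pi _
  have hcos : Real.cos (A / c) = 1 := by
    rw [hμ, mul_comm]
    exact Real.cos_nat_mul_two_pi n
  refine ⟨fun h => ?_, thresholdA_bounds, fun h _ => ?_⟩
  · have h2 : 2 ≤ A ^ 2 := (Real.sqrt_le_iff.1 h).2
    obtain ⟨Φ, -, h3, h4, h5⟩ := exists_travellingWave hp hν hc hA0 hA2 hsin hcos fun z hz => by
      have : -1 ≤ Real.sin z / z := by
        rw [le_div_iff₀ hz]; linarith [neg_lt_sin hz]
      linarith
    obtain ⟨h6, h7⟩ := h5 h2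
    exact ⟨Φ, h6, h7, h3, h4⟩
  · obtain ⟨Φ, h3, h4, h5, -⟩ := exists_travellingWave hp hν hc hA0 hA2 hsin hcos
      fun z hz => add_sin_div_nonneg_of_threshold_le h hz
    exact ⟨Φ, h3, h4, h5⟩
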